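/- **Growth lemma.** Let $k\ge 1$, $d\ge 2$, and let $f=[P_0:\dots:P_k]$ be a holomorphic endomorphism of $\mathbb{CP}^k$ of degree $d$, i.e. the $P_i$ are homogeneous polynomials of degree $d$ in $k+1$ variables with no common zero except the origin. Let $\omega$ be the Fubini–Study $(1,1)$-form on $\mathbb{CP}^k$, and let $\{B_j\}_{j\in J}$ be a finite covering of $\mathbb{CP}^k$ by open sets, each of which is contained in, and bounded in, some affine chart of $\mathbb{CP}^k$. Write $\mathbb D^l(r)=\{z\in\mathbb C^l : \max_i|z_i|<r\}$ and $\mathbb D^l=\mathbb D^l(1)$. Call a holomorphic map $\eta:\mathbb D^l(2)\to\mathbb{CP}^k$ *bounded* if its image is contained in some $B_j$. Then there is a constant $C>0$, depending only on $f$ (hence on $k$ and $d$) and on the covering $\{B_j\}$, such that for every $1\le l\le k$, every bounded holomorphic polydisc $\eta:\mathbb D^l(2)\to\mathbb{CP}^k$ and every $m\ge 1$, $$\operatorname{Vol}\bigl(f^m\circ\eta|_{\mathbb D^l}\bigr):=\int_{\mathbb D^l}(f^m\circ\eta)^*\omega^l\ \le\ C\,d^{\,lm},$$ the integral being absolutely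 convergent. -/

import Mathlib

open MeasureTheory Filter Topology

open scoped LinearAlgebra.Projectivization

noncomputable section

/-- The space `ℂ^{k+1}` of homogeneous coordinates, with its standard Hermitian product. -/
abbrev HomCoord (k : ℕ) : Type := EuclideanSpace ℂ (Fin (k + 1))

/-- Complex projective space of dimension `k`: the lines of `ℂ^{k+1}`. -/
abbrev CP (k : ℕ) : Type := ℙ ℂ (HomCoord k)

/-- The quotient topology of `ℂ^{k+1} ∖ {0} → CP k`. -/
instance CP.instTopologicalSpace (k : ℕ) : TopologicalSpace (CP k) :=
  TopologicalSpace.coinduced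
    (fun v : {v : HomCoord k // v ≠ 0} => Projectivization.mk ℂ v.1 v.2) inferInstance

/-- The affine open set `{ℓ ≠ 0}` of `CP k`, for a linear form `ℓ` on `ℂ^{k+1}`. For the
coordinate forms `ℓ = Z_i` these are the standard affine open sets. -/
def affineOpen {k : ℕ} (ℓ : HomCoord k →L[ℂ] ℂ) : Set (CP k) := {p | ℓ p.rep ≠ 0}

/-- The affine chart `[v] ↦ v / ℓ(v)` from `{ℓ ≠ 0}` onto the affine space
`{ℓ = 1} ≅ ℂ^k`. For `ℓ = Z_i` this is `[v] ↦ (v_0 / v_i, …, v_k / v_i)`. -/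
def affineChart {k : ℕ} (ℓ : HomCoord k →L[ℂ] ℂ) (p : CP k) : HomCoord k :=
  (ℓ p.rep)⁻¹ • p.rep

theorem affineChart_mk {k : ℕ} (ℓ : HomCoord k →L[ℂ] ℂ) (v : HomCoord k) (hv : v ≠ 0) :
    affineChart ℓ (Projectivization.mk ℂ v hv) = (ℓ v)⁻¹ • v := by
  obtain ⟨a, ha⟩ := Projectivization.exists_smul_eq_mk_rep ℂ v hv
  have ha0 : (a : ℂ) ≠ 0 := a.ne_zero
  have h : (Projectivization.mk ℂ v hv).rep = (a : ℂ) • v := ha.symm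
  unfold affineChart
  rw [h, map_smul, smul_smul, smul_eq_mul, mul_inv, mul_comm, mul_inv_cancel_left₀ ha0]

/-- The set `B` is contained in some affine chart of `CP k`, and bounded there. -/
def IsBoundedInAffineChart {k : ℕ} (B : Set (CP k)) : Prop :=
  ∃ ℓ : HomCoord k →L[ℂ] ℂ, B ⊆ affineOpen ℓ ∧ Bornology.IsBounded (affineChart ℓ '' B)

/-- Holomorphic maps from an open set `U` to `CP k`: continuous, and holomorphic in the affine
charts. -/
def IsHolomorphicOn {E : Type*} [NormedAddCommGroup E] [NormedSpace ℂ E] {k : ℕ}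
    (η : E → CP k) (U : Set E) : Prop :=
  ContinuousOn η U ∧
    ∀ ℓ : HomCoord k →L[ℂ] ℂ,
      DifferentiableOn ℂ (fun x => affineChart ℓ (η x)) (U ∩ η ⁻¹' affineOpen ℓ)

/-- The map `v ↦ (P_0(v), …, P_k(v))` of `ℂ^{k+1}`. -/
def polyMap {k : ℕ} (P : Fin (k + 1) → MvPolynomial (Fin (k + 1)) ℂ) (v : HomCoord k) :
    HomCoord k :=
  WithLp.toLp 2 fun i => MvPolynomial.eval (fun j => v j) (P i)

/-- `f` is a holomorphic endomorphism of `CP k` of degree `d`: in homogeneous coordinates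
`f = [P_0 : … : P_k]`, where the `P_i` are homogeneous polynomials of degree `d` without common
zero except the origin. -/
def IsEndomorphismOfDegree {k : ℕ} (d : ℕ) (f : CP k → CP k) : Prop :=
  ∃ P : Fin (k + 1) → MvPolynomial (Fin (k + 1)) ℂ,
    (∀ i, (P i).IsHomogeneous d) ∧
    ∃ hP : ∀ v : HomCoord k, v ≠ 0 → polyMap P v ≠ 0,
      ∀ (v : HomCoord k) (hv : v ≠ 0),
        f (Projectivization.mk ℂ v hv) = Projectivization.mk ℂ (polyMap P v) (hP v hv)

/-- The Fubini–Study form in homogeneous coordinates, `(i/2π) ∂∂̄ log ‖Z‖²`, at the point `Z` of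
`ℂ^{k+1} ∖ {0}` and on the tangent vectors `a`, `b`. (Mathlib's inner product is conjugate linear
in its first argument.) On an affine space `{ℓ = 1}` it restricts to the Fubini–Study form of
`CP k` in the affine chart of `ℓ`; it is normalised so that a projective line has area `1`. -/
def fubiniStudy {k : ℕ} (Z a b : HomCoord k) : ℝ :=
  (inner ℂ a b * inner ℂ Z Z - inner ℂ a Z * inner ℂ Z b).im / (Real.pi * ‖Z‖ ^ 4)

/-- The form `fubiniStudy` is basic for the action of `ℂˣ`, so that it descends to `CP k`. -/
theorem fubiniStudy_basic {k : ℕ} (Z a b : HomCoord k) (c s t : ℂ) (hc : c ≠ 0) :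
    fubiniStudy (c • Z) (c • a + s • Z) (c • b + t • Z) = fubiniStudy Z a b := by
  have key : inner ℂ (c • a + s • Z) (c • b + t • Z) * inner ℂ (c • Z) (c • Z)
      - inner ℂ (c • a + s • Z) (c • Z) * inner ℂ (c • Z) (c • b + t • Z)
      = ((‖c‖ ^ 4 : ℝ) : ℂ) * (inner ℂ a b * inner ℂ Z Z - inner ℂ a Z * inner ℂ Z b) := by
    have h : ((‖c‖ ^ 4 : ℝ) : ℂ) = (starRingEnd ℂ c * c) ^ 2 := by
      rw [Complex.conj_mul']
      push_cast
      ring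
    rw [h]
    simp only [inner_add_left, inner_add_right, inner_smul_left, inner_smul_right]
    ring
  have hc' : ‖c‖ ^ 4 ≠ 0 := pow_ne_zero _ (norm_ne_zero_iff.2 hc)
  unfold fubiniStudy
  rw [key, Complex.im_ofReal_mul, norm_smul, mul_pow, mul_left_comm,
    mul_div_mul_left _ _ hc']

/-- A linear form which does not vanish at `p`, namely `⟨v, ·⟩` for a representative `v` of `p`. -/
def centeredForm {k : ℕ} (p : CP k) : HomCoord k →L[ℂ] ℂ := innerSL ℂ p.rep

/-- The pull-back `η^* ω` of the Fubini–Study form by a holomorphic map `η` to `CP k`, at the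
point `x` and on the tangent vectors `u`, `w`. It is computed in an affine chart around `η x`;
`pullbackFS_eq` shows that the choice does not matter. -/
def pullbackFS {E : Type*} [NormedAddCommGroup E] [NormedSpace ℂ E] {k : ℕ}
    (η : E → CP k) (x u w : E) : ℝ :=
  let F : E → HomCoord k := fun y => affineChart (centeredForm (η x)) (η y)
  fubiniStudy (F x) (fderiv ℂ F x u) (fderiv ℂ F x w)

/-- The pull-back can be computed by means of any holomorphic lift of `η` to `ℂ^{k+1} ∖ {0}`. -/
theorem pullbackFS_eq {E : Type*} [NormedAddCommGroup E] [NormedSpace ℂ E] {k : ℕ}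
    (η : E → CP k) (x u w : E) (F : E → HomCoord k) (hF : DifferentiableAt ℂ F x)
    (hη : ∀ᶠ y in 𝓝 x, ∃ h : F y ≠ 0, η y = Projectivization.mk ℂ (F y) h) :
    pullbackFS η x u w = fubiniStudy (F x) (fderiv ℂ F x u) (fderiv ℂ F x w) := by
  obtain ⟨h0, hx⟩ := hη.self_of_nhds
  set ℓ := centeredForm (η x) with hℓ
  have hℓx : ℓ (F x) ≠ 0 := by
    obtain ⟨a, ha⟩ := Projectivization.exists_smul_eq_mk_rep ℂ (F x) h0
    rw [← hx] at ha
    have h1 : ℓ (η x).rep ≠ 0 := by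
      rw [hℓ]
      simpa [centeredForm] using (η x).rep_nonzero
    rw [← ha] at h1
    intro h2
    apply h1
    change ℓ ((a : ℂ) • F x) = 0
    rw [map_smul, h2, smul_zero]
  have hc : DifferentiableAt ℂ (fun y => (ℓ (F y))⁻¹) x :=
    (ℓ.differentiableAt.comp x hF).inv hℓx
  have hG : (fun y => affineChart ℓ (η y)) =ᶠ[𝓝 x] fun y => (ℓ (F y))⁻¹ • F y := by
    filter_upwards [hη] with y hy
    obtain ⟨h, hy⟩ := hy
    rw [hy, affineChart_mk]
  have hD := hG.fderiv_eq (𝕜 := ℂ)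
  rw [fderiv_fun_smul hc hF] at hD
  unfold pullbackFS
  simp only [← hℓ]
  have hx' : affineChart ℓ (η x) = (ℓ (F x))⁻¹ • F x := hG.self_of_nhds
  rw [hD, hx']
  exact fubiniStudy_basic _ _ _ _ _ _ (inv_ne_zero hℓx)

/-- The `l`-th exterior power `ω^l = ω ∧ ⋯ ∧ ω` of an alternating 2-form `ω`:
`ω^l (v_1, …, v_{2l}) = 2^{-l} ∑_σ sgn σ ∏_a ω (v_{σ(2a-1)}, v_{σ(2a)})`. The `2l` arguments are
indexed by `Fin l × Fin 2`. -/
def wedgePow {E : Type*} (ω : E → E → ℝ) (l : ℕ) (v : Fin l × Fin 2 → E) : ℝ :=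
  ((2 : ℝ) ^ l)⁻¹ * ∑ σ : Equiv.Perm (Fin l × Fin 2),
    ((Equiv.Perm.sign σ : ℤ) : ℝ) * ∏ a : Fin l, ω (v (σ (a, 0))) (v (σ (a, 1)))

/-- The standard oriented real basis `(e_1, i e_1, …, e_l, i e_l)` of `ℂ^l`. -/
def realFrame (l : ℕ) (p : Fin l × Fin 2) : Fin l → ℂ :=
  Pi.single p.1 (if p.2 = 0 then 1 else Complex.I)

/-- The open polydisc `𝔻^l(r)`; the norm of `Fin l → ℂ` is the maximum norm. -/
def polydisc (l : ℕ) (r : ℝ) : Set (Fin l → ℂ) := Metric.ball 0 r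

/-- The density of the top degree form `η^* ω^l` with respect to Lebesgue measure of `ℂ^l`. -/
def volumeDensity {k l : ℕ} (η : (Fin l → ℂ) → CP k) (x : Fin l → ℂ) : ℝ :=
  wedgePow (pullbackFS η x) l (realFrame l)

/-- The volume `∫_{𝔻^l(r)} η^* ω^l` of `η` on `𝔻^l(r)`, counted with multiplicity. -/
def polydiscVolume {k l : ℕ} (η : (Fin l → ℂ) → CP k) (r : ℝ) : ℝ :=
  ∫ x in polydisc l r, volumeDensity η x

/-- Relative to a covering `B` of `CP k`, the polydisc `η : 𝔻^l(r) → CP k` is bounded: its image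
is contained in some member of the covering. -/
def IsBoundedPolydisc {k l : ℕ} {J : Type*} (B : J → Set (CP k)) (η : (Fin l → ℂ) → CP k)
    (r : ℝ) : Prop :=
  ∃ j, Set.MapsTo η (polydisc l r) (B j)

end

/-! A bounded polydisc `η` lifts through one affine chart to a holomorphic map `F` with `log ‖F‖`
bounded. If `Q = polyMap P`, then `G = Q^m ∘ F` lifts `f^m ∘ η`, and the pull-back of the
Fubini–Study form is `(4π)⁻¹ dd^c log ‖G‖²`. Homogeneity of `Q` and compactness of the unit sphere
give `|log ‖Q v‖ - d log ‖v‖| ≤ c`; iterating, `|log ‖G‖| ≤ A d^m` with `A` independent of `η` and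
`m` (`abs_log_norm_iterate_sub_le`). After rescaling, `log ‖G‖` becomes a plurisubharmonic function
with values in `[0, 1]`, at the cost of a factor `(A d^m / π)^l` on the volume
(`volume_le_of_lift`).

What remains is the Chern–Levine–Nirenberg inequality `exists_integral_wedgePow_levi_le`: for such
`u` the mass of `(dd^c u)^l` on the unit polydisc is bounded by a constant depending on `l` alone. A
convex gluing of `u` with a fixed barrier `φ` gives a plurisubharmonic `v` equal to `u` plus a
constant on the unit polydisc and to `φ` outside a compact set `K`. By Stokes
(`integral_wedgePow_levi_sub`) `v` and `φ` have the same mass on `K`, and since `(dd^c v)^l ≥ 0`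
(`wedgePow_nonneg`) the mass of `u` on the unit polydisc is at most that of `φ` on `K`. -/

noncomputable section

/-! ### Linear algebra: positivity of top exterior powers of `(1,1)`-forms -/

/-- The multilinear map `v ↦ ∏_a ω (v (a, 0), v (a, 1))`. -/
def pairingProd {E : Type*} [AddCommGroup E] [Module ℝ E] (ω : E →ₗ[ℝ] E →ₗ[ℝ] ℝ) (l : ℕ) :
    MultilinearMap ℝ (fun _ : Fin l × Fin 2 => E) ℝ where
  toFun v := ∏ a : Fin l, ω (v (a, 0)) (v (a, 1))
  map_update_add' := by
    intro dec v p x y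
    obtain ⟨a, ε⟩ := p
    obtain rfl : dec = instDecidableEqProd := Subsingleton.elim _ _
    have key : ∀ z, ∏ b : Fin l, ω (Function.update v (a, ε) z (b, 0))
        (Function.update v (a, ε) z (b, 1)) =
        ω (Function.update v (a, ε) z (a, 0)) (Function.update v (a, ε) z (a, 1)) *
          ∏ b ∈ Finset.univ.erase a, ω (v (b, 0)) (v (b, 1)) := by
      intro z
      rw [← Finset.mul_prod_erase Finset.univ _ (Finset.mem_univ a)]
      congr 1
      refine Finset.prod_congr rfl fun b hb => ?_
      have hb : b ≠ a := Finset.ne_of_mem_erase hb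
      simp [Function.update, hb]
    simp only [key]
    fin_cases ε <;> simp [Function.update, add_mul]
  map_update_smul' := by
    intro dec v p c x
    obtain ⟨a, ε⟩ := p
    obtain rfl : dec = instDecidableEqProd := Subsingleton.elim _ _
    have key : ∀ z, ∏ b : Fin l, ω (Function.update v (a, ε) z (b, 0))
        (Function.update v (a, ε) z (b, 1)) =
        ω (Function.update v (a, ε) z (a, 0)) (Function.update v (a, ε) z (a, 1)) *
          ∏ b ∈ Finset.univ.erase a, ω (v (b, 0)) (v (b, 1)) := by
      intro z
      rw [← Finset.mul_prod_erase Finset.univ _ (Finset.mem_univ a)]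
      congr 1
      refine Finset.prod_congr rfl fun b hb => ?_
      have hb : b ≠ a := Finset.ne_of_mem_erase hb
      simp [Function.update, hb]
    simp only [key]
    fin_cases ε <;> simp [Function.update, mul_assoc]

theorem wedgePow_eq_alternatization {E : Type*} [AddCommGroup E] [Module ℝ E]
    (ω : E →ₗ[ℝ] E →ₗ[ℝ] ℝ) (l : ℕ) (v : Fin l × Fin 2 → E) :
    wedgePow (fun a b => ω a b) l v
      = ((2 : ℝ) ^ l)⁻¹ * MultilinearMap.alternatization (pairingProd ω l) v := by
  unfold wedgePow
  rw [MultilinearMap.alternatization_apply]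
  congr 1
  refine Finset.sum_congr rfl fun σ _ => ?_
  simp [pairingProd, Units.smul_def]

theorem wedgePow_smul {E : Type*} (c : ℝ) (ω : E → E → ℝ) (l : ℕ) (v : Fin l × Fin 2 → E) :
    wedgePow (fun a b => c * ω a b) l v = c ^ l * wedgePow ω l v := by
  unfold wedgePow
  rw [mul_left_comm, Finset.mul_sum _ _ (c ^ l)]
  congr 1
  refine Finset.sum_congr rfl fun σ _ => ?_
  rw [Finset.prod_mul_distrib]
  simp
  ring

/-- The real basis `(e_1, i e_1, …, e_l, i e_l)` of `ℂ^l`. -/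
def realFrameBasis (l : ℕ) : Module.Basis (Fin l × Fin 2) ℝ (Fin l → ℂ) :=
  ((Pi.basis fun _ : Fin l => Complex.basisOneI).reindex (Equiv.sigmaEquivProd _ _))

theorem realFrameBasis_apply (l : ℕ) (p : Fin l × Fin 2) :
    realFrameBasis l p = realFrame l p := by
  obtain ⟨a, ε⟩ := p
  fin_cases ε <;> simp [realFrameBasis, realFrame]

/-- The standard Kähler form `∑ Im (conj a_i * b_i)` of `ℂ^l`. -/
def stdKahler (l : ℕ) : (Fin l → ℂ) →ₗ[ℝ] (Fin l → ℂ) →ₗ[ℝ] ℝ :=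
  LinearMap.mk₂ ℝ (fun a b => (star a ⬝ᵥ b).im)
    (by intro a b c; simp [add_dotProduct])
    (by intro r a b; simp [dotProduct, Finset.mul_sum]; congr; ext; ring)
    (by intro a b c; simp [dotProduct_add])
    (by intro r a b; simp [dotProduct, Finset.mul_sum]; congr; ext; ring)

theorem stdKahler_apply {l : ℕ} (a b : Fin l → ℂ) : stdKahler l a b = (star a ⬝ᵥ b).im := rfl

theorem stdKahler_realFrame {l : ℕ} (p q : Fin l × Fin 2) :
    stdKahler l (realFrame l p) (realFrame l q)
      = if p.1 = q.1 then (if p.2 = q.2 then 0 else if p.2 = 0 then 1 else -1) else 0 := by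
  obtain ⟨a, ε⟩ := p
  obtain ⟨b, δ⟩ := q
  rw [stdKahler_apply]
  by_cases h : a = b
  · subst h
    fin_cases ε <;> fin_cases δ <;> simp [realFrame, dotProduct, Pi.single_apply]
  · simp only [realFrame, dotProduct, Pi.single_apply, Pi.star_apply]
    rw [Finset.sum_eq_zero]
    · simp [h]
    · intro c _
      by_cases hc : c = a
      · subst hc; simp [h]
      · simp [hc]

/-- A nonzero product forces `σ` to map each pair `{(a, 0), (a, 1)}` onto a pair. Then `σ` is a
family of flips `τ` inside the pairs followed by a permutation `π` of the pairs. As `π` acts on both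
slots at once its sign is squared away, and each flip changes both the sign of `σ` and the sign of
one factor. -/
theorem sign_mul_prod_stdKahler_nonneg {l : ℕ} (σ : Equiv.Perm (Fin l × Fin 2)) :
    0 ≤ ((Equiv.Perm.sign σ : ℤ) : ℝ) *
      ∏ a : Fin l, stdKahler l (realFrame l (σ (a, 0))) (realFrame l (σ (a, 1))) := by
  by_cases h : ∀ a, (σ (a, 0)).1 = (σ (a, 1)).1
  swap
  · push Not at h
    obtain ⟨a, ha⟩ := h
    rw [Finset.prod_eq_zero (Finset.mem_univ a), mul_zero]
    rw [stdKahler_realFrame, if_neg ha]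
  have hne : ∀ a, (σ (a, 0)).2 ≠ (σ (a, 1)).2 := by
    intro a h2
    have := σ.injective (Prod.ext (h a) h2)
    simp at this
  have h1 : ∀ a ε, (σ (a, ε)).1 = (σ (a, 0)).1 := by
    intro a ε
    fin_cases ε
    · rfl
    · exact (h a).symm
  have hinj : Function.Injective fun a => (σ (a, 0)).1 := by
    intro a b hab
    by_contra hne'
    simp only at hab
    have hb : (σ (b, 0)).2 = (σ (a, 0)).2 ∨ (σ (b, 0)).2 = (σ (a, 1)).2 := by
      have := hne a
      omega
    rcases hb with hb | hb
    · have := σ.injective (Prod.ext hab hb.symm)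
      simp at this; exact hne' this
    · have := σ.injective (Prod.ext ((h a).symm.trans hab) hb.symm)
      simp at this
  let π : Equiv.Perm (Fin l) := Equiv.ofBijective _ (Finite.injective_iff_bijective.1 hinj)
  let τ : Fin l → Equiv.Perm (Fin 2) := fun a =>
    if (σ (a, 0)).2 = 0 then 1 else Equiv.swap 0 1
  have hσ : σ = Equiv.prodCongrLeft (fun _ : Fin 2 => π) * Equiv.prodCongrRight τ := by
    ext1 ⟨a, ε⟩
    have hτ : τ a ε = (σ (a, ε)).2 := by
      have := hne a
      simp only [τ]
      split_ifs with h0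
      · fin_cases ε
        · simp [h0]
        · simp; omega
      · fin_cases ε
        · simp; omega
        · simp; omega
    refine Prod.ext ?_ ?_
    · simp [π, h1 a ε]
    · simp [hτ]
  have hs : Equiv.Perm.sign σ = ∏ a, Equiv.Perm.sign (τ a) := by
    conv_lhs => rw [hσ]
    rw [Equiv.Perm.sign_mul, Equiv.Perm.sign_prodCongrLeft, Equiv.Perm.sign_prodCongrRight]
    simp
  rw [hs]
  push_cast
  rw [← Finset.prod_mul_distrib]
  refine Finset.prod_nonneg fun a _ => ?_
  rw [stdKahler_realFrame, if_pos (h a), if_neg (hne a)]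
  by_cases h0 : (σ (a, 0)).2 = 0 <;> simp [τ, h0]

/-- Top degree alternating forms pull back by the real determinant, which for a complex linear `A`
is `|det A|² ≥ 0`. -/
theorem wedgePow_stdKahler_comp_nonneg {l : ℕ} (A : (Fin l → ℂ) →ₗ[ℂ] (Fin l → ℂ)) :
    0 ≤ wedgePow (fun a b => stdKahler l (A a) (A b)) l (realFrame l) := by
  have h : wedgePow (fun a b => stdKahler l (A a) (A b)) l (realFrame l)
      = wedgePow (fun a b => stdKahler l a b) l (fun p => A (realFrame l p)) := rfl
  have hdet : 0 ≤ LinearMap.det (A.restrictScalars ℝ) := by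
    rw [LinearMap.det_restrictScalars, Algebra.norm_complex_apply]
    exact Complex.normSq_nonneg _
  have hfr : (fun p => A (realFrame l p)) = fun p => (A.restrictScalars ℝ) (realFrameBasis l p) := by
    ext p
    simp [realFrameBasis_apply]
  have hb : (⇑(realFrameBasis l)) = realFrame l := funext (realFrameBasis_apply l)
  rw [h, wedgePow_eq_alternatization, hfr,
    (MultilinearMap.alternatization (pairingProd (stdKahler l) l)).eq_smul_basis_det
      (realFrameBasis l)]
  have hc : (realFrameBasis l).det (fun p => (A.restrictScalars ℝ) (realFrameBasis l p))
      = LinearMap.det (A.restrictScalars ℝ) := by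
    have := (realFrameBasis l).det_comp (A.restrictScalars ℝ) (realFrameBasis l)
    rw [Module.Basis.det_self, mul_one] at this
    exact this
  rw [AlternatingMap.smul_apply, hc, smul_eq_mul]
  refine mul_nonneg (by positivity) (mul_nonneg ?_ hdet)
  rw [MultilinearMap.alternatization_apply, hb]
  refine Finset.sum_nonneg fun σ _ => ?_
  have := sign_mul_prod_stdKahler_nonneg σ
  simpa [pairingProd, Units.smul_def] using this

open scoped ComplexOrder MatrixOrder in
/-- The top exterior power of a positive `(1,1)`-form on `ℂ^l` is nonnegative. -/
theorem wedgePow_nonneg {l : ℕ} (ω : (Fin l → ℂ) →ₗ[ℝ] (Fin l → ℂ) →ₗ[ℝ] ℝ)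
    (halt : ∀ a b, ω a b = - ω b a)
    (hJ : ∀ a b, ω (Complex.I • a) (Complex.I • b) = ω a b)
    (hpos : ∀ a, 0 ≤ ω a (Complex.I • a)) :
    0 ≤ wedgePow (fun a b => ω a b) l (realFrame l) := by
  -- The Hermitian form with imaginary part `ω`. Positivity of `ω` makes its matrix `H` positive
  -- semidefinite.
  set h : (Fin l → ℂ) → (Fin l → ℂ) → ℂ :=
    fun a b => (ω a (Complex.I • b) : ℂ) + Complex.I * (ω a b : ℂ) with hh
  have hII : ∀ a : Fin l → ℂ, Complex.I • Complex.I • a = -a := by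
    intro a; rw [smul_smul, Complex.I_mul_I, neg_one_smul]
  have hJ' : ∀ a b, ω (Complex.I • a) b = - ω a (Complex.I • b) := by
    intro a b
    rw [← hJ a (Complex.I • b), hII, map_neg, neg_neg]
  have hsr : ∀ (z : ℂ) (a : Fin l → ℂ), z • a = z.re • a + z.im • (Complex.I • a) := by
    intro z a
    ext i
    simp only [Pi.smul_apply, Pi.add_apply, smul_eq_mul, Complex.real_smul]
    conv_lhs => rw [← Complex.re_add_im z]
    ring
  have hsmul_right : ∀ (z : ℂ) a b, h a (z • b) = z * h a b := by
    intro z a b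
    have e : Complex.I • z • b = z.re • (Complex.I • b) - z.im • b := by
      rw [hsr z b, smul_add, smul_comm Complex.I z.re, smul_comm Complex.I z.im, hII, smul_neg]
      rfl
    simp only [hh]
    rw [e, hsr z b]
    simp only [map_add, map_sub, map_smul, smul_eq_mul]
    apply Complex.ext <;> simp
  have hsmul_left : ∀ (z : ℂ) a b, h (z • a) b = star z * h a b := by
    intro z a b
    simp only [hh]
    rw [hsr z a]
    simp only [map_add, map_smul, smul_eq_mul, LinearMap.add_apply, LinearMap.smul_apply, hJ', hII,
      map_neg]
    apply Complex.ext <;> simp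
  have hsum_right : ∀ a (s : Fin l → Fin l → ℂ), h a (∑ i, s i) = ∑ i, h a (s i) := by
    intro a s
    simp only [hh, Finset.smul_sum, map_sum, Complex.ofReal_sum, Finset.mul_sum,
      Finset.sum_add_distrib]
  have hsum_left : ∀ (s : Fin l → Fin l → ℂ) b, h (∑ i, s i) b = ∑ i, h (s i) b := by
    intro s b
    simp only [hh, map_sum, Complex.ofReal_sum, Finset.mul_sum,
      Finset.sum_add_distrib, LinearMap.sum_apply]
  have hherm : ∀ a b, star (h a b) = h b a := by
    intro a b
    simp only [hh]
    have h1 : ω a (Complex.I • b) = ω b (Complex.I • a) := by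
      rw [halt, hJ', neg_neg]
    rw [h1, halt a b]
    apply Complex.ext <;> simp
  set H : Matrix (Fin l) (Fin l) ℂ := fun i j => h (Pi.single i 1) (Pi.single j 1) with hH
  have hdec : ∀ a : Fin l → ℂ, a = ∑ i, a i • Pi.single i (1 : ℂ) := by
    intro a
    conv_lhs => rw [pi_eq_sum_univ' a]
  have hhH : ∀ a b, h a b = star a ⬝ᵥ H.mulVec b := by
    intro a b
    conv_lhs => rw [hdec a, hdec b]
    rw [hsum_left]
    simp only [hsum_right, hsmul_left, hsmul_right, dotProduct, Matrix.mulVec, Pi.star_apply, hH,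
      Finset.mul_sum]
    refine Finset.sum_congr rfl fun i _ => Finset.sum_congr rfl fun j _ => ?_
    ring
  have hPSD : H.PosSemidef := by
    refine Matrix.PosSemidef.of_dotProduct_mulVec_nonneg ?_ ?_
    · ext i j
      exact hherm _ _
    · intro x
      rw [← hhH]
      have h0 : ω x x = 0 := by have := halt x x; linarith
      rw [Complex.nonneg_iff]
      constructor
      · simpa [hh, h0] using hpos x
      · simp [hh, h0]
  -- Factoring `H = A* A` presents `ω` as the pull-back of the standard Kähler form by `A`, possibly
  -- degenerate.
  obtain ⟨A, hA⟩ : ∃ A : Matrix (Fin l) (Fin l) ℂ, H = A.conjTranspose * A := by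
    have hS : (CFC.sqrt H).IsHermitian :=
      (Matrix.nonneg_iff_posSemidef.1 (CFC.sqrt_nonneg H)).isHermitian
    refine ⟨CFC.sqrt H, ?_⟩
    rw [hS.eq, CFC.sqrt_mul_sqrt_self H (Matrix.nonneg_iff_posSemidef.2 hPSD)]
  have hω : (fun a b => ω a b) = fun a b => stdKahler l (Matrix.toLin' A a) (Matrix.toLin' A b) := by
    ext a b
    have h1 : ω a b = (h a b).im := by simp [hh]
    rw [h1, hhH, hA, stdKahler_apply, Matrix.toLin'_apply, Matrix.toLin'_apply, Matrix.star_mulVec,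
      ← Matrix.mulVec_mulVec, Matrix.dotProduct_mulVec]
  rw [hω]
  exact wedgePow_stdKahler_comp_nonneg _

/-! ### Calculus of `dd^c` -/

theorem fderiv_fderiv_apply {E : Type*} [NormedAddCommGroup E] [NormedSpace ℝ E]
    {u : E → ℝ} {x : E} (hu : ContDiffAt ℝ 2 u x) (b c : E) :
    fderiv ℝ (fun y => fderiv ℝ u y c) x b = fderiv ℝ (fderiv ℝ u) x b c := by
  have h : DifferentiableAt ℝ (fderiv ℝ u) x :=
    (hu.fderiv_right (m := 1) (by norm_num)).differentiableAt (by norm_num)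
  rw [fderiv_clm_apply h (differentiableAt_const c)]
  simp

section Levi

variable {E : Type*} [NormedAddCommGroup E] [NormedSpace ℝ E] [NormedSpace ℂ E]

/-- The form `dd^c u`, where `d^c u (b) = -du (i b)`. -/
def levi (u : E → ℝ) (x a b : E) : ℝ :=
  fderiv ℝ (fun y => fderiv ℝ u y (Complex.I • a)) x b
    - fderiv ℝ (fun y => fderiv ℝ u y (Complex.I • b)) x a

theorem levi_eq {u : E → ℝ} {x : E} (hu : ContDiffAt ℝ 2 u x) (a b : E) :
    levi u x a b = fderiv ℝ (fderiv ℝ u) x b (Complex.I • a)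
      - fderiv ℝ (fderiv ℝ u) x a (Complex.I • b) := by
  unfold levi
  rw [fderiv_fderiv_apply hu, fderiv_fderiv_apply hu]

theorem levi_congr {u v : E → ℝ} {x : E} (h : u =ᶠ[𝓝 x] v) (a b : E) :
    levi u x a b = levi v x a b := by
  have h' := h.fderiv (𝕜 := ℝ)
  have key : ∀ c, (fun y => fderiv ℝ u y c) =ᶠ[𝓝 x] fun y => fderiv ℝ v y c :=
    fun c => h'.mono fun y hy => by simp only [hy]
  unfold levi
  rw [(key _).fderiv_eq, (key _).fderiv_eq]

theorem levi_add {u v : E → ℝ} {x : E} (hu : ContDiffAt ℝ 2 u x) (hv : ContDiffAt ℝ 2 v x)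
    (a b : E) : levi (fun y => u y + v y) x a b = levi u x a b + levi v x a b := by
  have hu' : DifferentiableAt ℝ (fderiv ℝ u) x :=
    (hu.fderiv_right (m := 1) (by norm_num)).differentiableAt (by norm_num)
  have hv' : DifferentiableAt ℝ (fderiv ℝ v) x :=
    (hv.fderiv_right (m := 1) (by norm_num)).differentiableAt (by norm_num)
  have h : fderiv ℝ (fun y => u y + v y) =ᶠ[𝓝 x] fun y => fderiv ℝ u y + fderiv ℝ v y := by
    filter_upwards [hu.eventually (by simp), hv.eventually (by simp)] with y h1 h2
    exact fderiv_fun_add (h1.differentiableAt (by norm_num)) (h2.differentiableAt (by norm_num))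
  rw [levi_eq (hu.add hv), levi_eq hu, levi_eq hv, h.fderiv_eq, fderiv_fun_add hu' hv']
  simp only [add_apply]
  ring

theorem levi_add_const (u : E → ℝ) (c : ℝ) (x a b : E) :
    levi (fun y => u y + c) x a b = levi u x a b := by
  unfold levi
  simp only [fderiv_add_const]

theorem levi_const_mul {u : E → ℝ} {x : E} (hu : ContDiffAt ℝ 2 u x) (c : ℝ) (a b : E) :
    levi (fun y => c * u y) x a b = c * levi u x a b := by
  have hu' : DifferentiableAt ℝ (fderiv ℝ u) x :=
    (hu.fderiv_right (m := 1) (by norm_num)).differentiableAt (by norm_num)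
  have h : fderiv ℝ (fun y => c * u y) =ᶠ[𝓝 x] fun y => c • fderiv ℝ u y := by
    filter_upwards [hu.eventually (by simp)] with y h1
    exact fderiv_const_mul (h1.differentiableAt (by norm_num)) c
  rw [levi_eq (contDiffAt_const.mul hu), levi_eq hu, h.fderiv_eq, fderiv_fun_const_smul hu']
  simp only [smul_apply, smul_eq_mul]
  ring

/-- For `b = i a` the bracket of the second term is `dt(i a)² + dt(a)²`, so a convex `g` contributes
a nonnegative term. -/
theorem levi_comp {t : E → ℝ} {g : ℝ → ℝ} {x : E} (ht : ContDiffAt ℝ 2 t x)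
    (hg : ContDiffAt ℝ 2 g (t x)) (a b : E) :
    levi (fun y => g (t y)) x a b = deriv g (t x) * levi t x a b
      + deriv (deriv g) (t x) * (fderiv ℝ t x b * fderiv ℝ t x (Complex.I • a)
        - fderiv ℝ t x a * fderiv ℝ t x (Complex.I • b)) := by
  have key : ∀ b c, fderiv ℝ (fun y => fderiv ℝ (fun z => g (t z)) y c) x b
      = deriv g (t x) * fderiv ℝ (fun y => fderiv ℝ t y c) x b
        + deriv (deriv g) (t x) * (fderiv ℝ t x b * fderiv ℝ t x c) := by
    intro b c
    have h : (fun y => fderiv ℝ (fun z => g (t z)) y c) =ᶠ[𝓝 x]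
        fun y => deriv g (t y) * fderiv ℝ t y c := by
      filter_upwards [ht.eventually (by simp),
        ht.continuousAt.eventually (hg.eventually (by simp))] with y h1 h2
      have h3 := (h2.differentiableAt (by norm_num)).hasDerivAt.comp_hasFDerivAt y
        (h1.differentiableAt (by norm_num)).hasFDerivAt
      have h4 : fderiv ℝ (fun z => g (t z)) y = deriv g (t y) • fderiv ℝ t y := h3.fderiv
      rw [h4]
      simp
    have hg' : DifferentiableAt ℝ (deriv g) (t x) := by
      have h1 : DifferentiableAt ℝ (fderiv ℝ g) (t x) :=
        (hg.fderiv_right (m := 1) (by norm_num)).differentiableAt (by norm_num)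
      have h2 : deriv g = fun y => fderiv ℝ g y 1 := by
        ext y; simp
      rw [h2]
      exact h1.clm_apply (differentiableAt_const _)
    have ht' : DifferentiableAt ℝ (fun y => fderiv ℝ t y c) x :=
      ((ht.fderiv_right (m := 1) (by norm_num)).differentiableAt (by norm_num)).clm_apply
        (differentiableAt_const _)
    have h5 := (hg'.hasDerivAt.comp_hasFDerivAt x
        (ht.differentiableAt (by norm_num)).hasFDerivAt).mul ht'.hasFDerivAt
    have h6 : fderiv ℝ (fun y => deriv g (t y) * fderiv ℝ t y c) x = _ := h5.fderiv
    rw [h.fderiv_eq, h6]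
    simp
    ring
  unfold levi
  rw [key, key]
  ring

theorem levi_antisymm (u : E → ℝ) (x a b : E) : levi u x a b = - levi u x b a := by
  unfold levi
  ring

theorem levi_I_smul {u : E → ℝ} {x : E} (hu : ContDiffAt ℝ 2 u x) (a b : E) :
    levi u x (Complex.I • a) (Complex.I • b) = levi u x a b := by
  have hII : ∀ a : E, Complex.I • Complex.I • a = -a := by
    intro a; rw [smul_smul, Complex.I_mul_I, neg_one_smul]
  have hs : IsSymmSndFDerivAt ℝ u x := hu.isSymmSndFDerivAt (by simp)
  rw [levi_eq hu, levi_eq hu, hII, hII, hs.eq _ (-a), hs.eq _ (-b)]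
  simp
  ring

end Levi

section LeviForm

variable {E : Type*} [NormedAddCommGroup E] [NormedSpace ℝ E] [NormedSpace ℂ E]
  [IsScalarTower ℝ ℂ E]

/-- `levi u x` as a bilinear map. -/
def leviForm (u : E → ℝ) (x : E) : E →ₗ[ℝ] E →ₗ[ℝ] ℝ :=
  LinearMap.mk₂ ℝ (fun a b => fderiv ℝ (fderiv ℝ u) x b (Complex.I • a)
      - fderiv ℝ (fderiv ℝ u) x a (Complex.I • b))
    (by intro a b c; simp; ring)
    (by intro r a b; simp only [smul_comm Complex.I r, map_smul]; simp; ring)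
    (by intro a b c; simp; ring)
    (by intro r a b; simp only [smul_comm Complex.I r, map_smul]; simp; ring)

theorem leviForm_apply {u : E → ℝ} {x : E} (hu : ContDiffAt ℝ 2 u x) (a b : E) :
    leviForm u x a b = levi u x a b := (levi_eq hu a b).symm

end LeviForm

/-! ### `dd^c log ‖G‖²` and the Fubini–Study form -/

section NormSq

variable {E F : Type*} [NormedAddCommGroup E] [NormedSpace ℝ E] [NormedSpace ℂ E]
  [IsScalarTower ℝ ℂ E]
  [NormedAddCommGroup F] [InnerProductSpace ℂ F] [NormedSpace ℝ F] [IsScalarTower ℝ ℂ F]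

theorem fderiv_normSq_comp {G : E → F} {x : E} (hG : DifferentiableAt ℂ G x) (c : E) :
    fderiv ℝ (fun y => ‖G y‖ ^ 2) x c = 2 * (inner ℂ (G x) (fderiv ℂ G x c)).re := by
  have h : (fun y => ‖G y‖ ^ 2) = fun y => Complex.reCLM (inner ℂ (G y) (G y)) := by
    ext y
    simp [← inner_self_eq_norm_sq (𝕜 := ℂ)]
  have hG' : HasFDerivAt G ((fderiv ℂ G x).restrictScalars ℝ) x :=
    hG.hasFDerivAt.restrictScalars ℝ
  have h1 := Complex.reCLM.hasFDerivAt.comp x (hG'.inner ℂ hG')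
  have h2 : fderiv ℝ (fun y => Complex.reCLM (inner ℂ (G y) (G y))) x = _ := h1.fderiv
  rw [h, h2]
  have h3 : (inner ℂ (fderiv ℂ G x c) (G x)).re = (inner ℂ (G x) (fderiv ℂ G x c)).re := by
    rw [← inner_conj_symm, Complex.conj_re]
  simp [h3]
  ring

/-- The terms containing `D²G` cancel, because `D²G` is symmetric and complex bilinear; only first
derivatives survive. -/
theorem levi_normSq {G : E → F} {x : E} (hG : ContDiffAt ℂ 2 G x) (a b : E) :
    levi (fun y => ‖G y‖ ^ 2) x a b = 4 * (inner ℂ (fderiv ℂ G x a) (fderiv ℂ G x b)).im := by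
  have hG' : HasFDerivAt G ((fderiv ℂ G x).restrictScalars ℝ) x :=
    (hG.differentiableAt (by norm_num)).hasFDerivAt.restrictScalars ℝ
  have hDG : DifferentiableAt ℂ (fderiv ℂ G) x :=
    (hG.fderiv_right (m := 1) (by norm_num)).differentiableAt (by norm_num)
  have key : ∀ b c, fderiv ℝ (fun y => fderiv ℝ (fun z => ‖G z‖ ^ 2) y c) x b
      = 2 * (inner ℂ (fderiv ℂ G x b) (fderiv ℂ G x c)).re
        + 2 * (inner ℂ (G x) (fderiv ℂ (fderiv ℂ G) x b c)).re := by
    intro b c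
    have h : (fun y => fderiv ℝ (fun z => ‖G z‖ ^ 2) y c) =ᶠ[𝓝 x]
        fun y => 2 * Complex.reCLM (inner ℂ (G y) (fderiv ℂ G y c)) := by
      filter_upwards [hG.eventually (by simp)] with y hy
      rw [fderiv_normSq_comp (hy.differentiableAt (by norm_num))]
      simp
    have hc : HasFDerivAt (fun y => fderiv ℂ G y c)
        (((ContinuousLinearMap.apply ℂ F c).comp (fderiv ℂ (fderiv ℂ G) x)).restrictScalars ℝ) x :=
      ((ContinuousLinearMap.apply ℂ F c).hasFDerivAt.comp x hDG.hasFDerivAt).restrictScalars ℝ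
    have h1 := (Complex.reCLM.hasFDerivAt.comp x (hG'.inner ℂ hc)).const_mul 2
    have h2 : fderiv ℝ (fun y => 2 * Complex.reCLM (inner ℂ (G y) (fderiv ℂ G y c))) x = _ :=
      h1.fderiv
    rw [h.fderiv_eq, h2]
    simp
    ring
  have hs : IsSymmSndFDerivAt ℂ G x := hG.isSymmSndFDerivAt (by simp)
  have e : (inner ℂ (fderiv ℂ G x b) (fderiv ℂ G x a)).im
      = - (inner ℂ (fderiv ℂ G x a) (fderiv ℂ G x b)).im := by
    rw [← inner_conj_symm, Complex.conj_im]
  unfold levi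
  rw [key, key]
  simp only [map_smul, inner_smul_right, hs.eq b a]
  simp [e]
  ring

theorem contDiffAt_normSq_comp {n : WithTop ℕ∞} {G : E → F} {x : E} (hG : ContDiffAt ℂ n G x) :
    ContDiffAt ℝ n (fun y => ‖G y‖ ^ 2) x := by
  have h1 : ContDiffAt ℝ n G x := hG.restrict_scalars ℝ
  have h2 : (fun y => ‖G y‖ ^ 2) = fun y => Complex.reCLM (inner ℂ (G y) (G y)) := by
    ext y
    simp [← inner_self_eq_norm_sq (𝕜 := ℂ)]
  rw [h2]
  exact Complex.reCLM.contDiff.contDiffAt.comp x (h1.inner ℂ h1)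

end NormSq

/-- With the convention of `levi`, `dd^c = 2i ∂∂̄`; the Fubini–Study form is `(i/2π) ∂∂̄ log ‖Z‖²`,
whence the factor `4π`. -/
theorem levi_log_normSq {E : Type*} [NormedAddCommGroup E] [NormedSpace ℝ E] [NormedSpace ℂ E]
    [IsScalarTower ℝ ℂ E] {k : ℕ} {G : E → HomCoord k} {x : E} (hG : ContDiffAt ℂ 2 G x)
    (h0 : G x ≠ 0) (a b : E) :
    levi (fun y => Real.log (‖G y‖ ^ 2)) x a b
      = 4 * Real.pi * fubiniStudy (G x) (fderiv ℂ G x a) (fderiv ℂ G x b) := by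
  have hN : ContDiffAt ℝ 2 (fun y => ‖G y‖ ^ 2) x := contDiffAt_normSq_comp hG
  have hpos : ‖G x‖ ^ 2 ≠ 0 := by simpa using h0
  have hlog : ContDiffAt ℝ 2 Real.log (‖G x‖ ^ 2) := Real.contDiffAt_log.2 hpos
  rw [levi_comp hN hlog, levi_normSq hG]
  simp only [fderiv_normSq_comp (hG.differentiableAt (by norm_num))]
  have hd : deriv (deriv Real.log) (‖G x‖ ^ 2) = - ((‖G x‖ ^ 2) ^ 2)⁻¹ := by
    rw [Real.deriv_log', deriv_inv]
  rw [hd, Real.deriv_log]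
  unfold fubiniStudy
  have e1 : inner ℂ (fderiv ℂ G x a) (G x) = starRingEnd ℂ (inner ℂ (G x) (fderiv ℂ G x a)) :=
    (inner_conj_symm _ _).symm
  have e2 : inner ℂ (G x) (G x) = ((‖G x‖ ^ 2 : ℝ) : ℂ) := by
    rw [inner_self_eq_norm_sq_to_K]; simp
  rw [e1, e2]
  simp only [map_smul, inner_smul_right]
  simp only [Complex.sub_im, Complex.mul_im, Complex.mul_re, Complex.I_re, Complex.I_im,
    Complex.conj_re, Complex.conj_im, Complex.ofReal_re, Complex.ofReal_im]
  have hpi := Real.pi_ne_zero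
  have hn : ‖G x‖ ≠ 0 := by simpa using h0
  field_simp
  ring

/-- This is the Cauchy–Schwarz inequality for `Z` and `a`. -/
theorem fubiniStudy_I_smul_nonneg {k : ℕ} (Z a : HomCoord k) :
    0 ≤ fubiniStudy Z a (Complex.I • a) := by
  unfold fubiniStudy
  refine div_nonneg ?_ (by positivity)
  have e1 : inner ℂ a Z = starRingEnd ℂ (inner ℂ Z a) := (inner_conj_symm _ _).symm
  have e2 : ∀ v : HomCoord k, inner ℂ v v = ((‖v‖ ^ 2 : ℝ) : ℂ) := by
    intro v
    rw [inner_self_eq_norm_sq_to_K]; simp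
  have h := norm_inner_le_norm (𝕜 := ℂ) Z a
  have h2 : ‖(inner ℂ Z a : ℂ)‖ ^ 2 ≤ (‖Z‖ * ‖a‖) ^ 2 := by gcongr
  rw [← Complex.normSq_eq_norm_sq, Complex.normSq_apply] at h2
  rw [inner_smul_right, inner_smul_right, e1, e2, e2]
  simp only [Complex.sub_im, Complex.mul_im, Complex.mul_re, Complex.I_re, Complex.I_im,
    Complex.conj_re, Complex.conj_im, Complex.ofReal_re, Complex.ofReal_im]
  nlinarith [h2]

/-! ### Stokes' theorem for products of exact 2-forms -/

theorem sum_sign_mul_eq_zero_of_swap {ι : Type*} [Fintype ι] [DecidableEq ι]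
    (X : Equiv.Perm ι → ℝ) {s t : ι} (hst : s ≠ t)
    (hX : ∀ σ, X (σ * Equiv.swap s t) = X σ) :
    ∑ σ : Equiv.Perm ι, ((Equiv.Perm.sign σ : ℤ) : ℝ) * X σ = 0 := by
  have h := Equiv.sum_comp (Equiv.mulRight (Equiv.swap s t))
    (fun σ : Equiv.Perm ι => ((Equiv.Perm.sign σ : ℤ) : ℝ) * X σ)
  simp only [Equiv.coe_mulRight, hX, Equiv.Perm.sign_mul, Equiv.Perm.sign_swap hst] at h
  simp only [mul_neg, mul_one, Units.val_neg, Int.cast_neg, neg_mul, Finset.sum_neg_distrib] at h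
  linarith

section Stokes

variable {E : Type*} [NormedAddCommGroup E] [NormedSpace ℝ E] {l : ℕ}

/-- The value on the pair of vectors `V p`, `V q` of the exterior derivative of the `1`-form with
coefficients `θ`. -/
def extDer {ι : Type*} (V : ι → E) (θ : ι → E → ℝ) (p q : ι) (x : E) : ℝ :=
  fderiv ℝ (θ q) x (V p) - fderiv ℝ (θ p) x (V q)

theorem contDiff_fderiv_apply {f : E → ℝ} {n m : WithTop ℕ∞} (hf : ContDiff ℝ n f)
    (hmn : m + 1 ≤ n) (v : E) :
    ContDiff ℝ m (fun y => fderiv ℝ f y v) :=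
  (hf.fderiv_right hmn).clm_apply contDiff_const

theorem contDiff_extDer {ι : Type*} (V : ι → E) {θ : ι → E → ℝ} (hθ : ∀ p, ContDiff ℝ 2 (θ p))
    (p q : ι) : ContDiff ℝ 1 (extDer V θ p q) :=
  (contDiff_fderiv_apply (hθ q) (by norm_num) _).sub
    (contDiff_fderiv_apply (hθ p) (by norm_num) _)

theorem fderiv_extDer {ι : Type*} (V : ι → E) {θ : ι → E → ℝ} (hθ : ∀ p, ContDiff ℝ 2 (θ p))
    (p q r : ι) (x : E) : fderiv ℝ (extDer V θ q r) x (V p)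
      = fderiv ℝ (fderiv ℝ (θ r)) x (V p) (V q) - fderiv ℝ (fderiv ℝ (θ q)) x (V p) (V r) := by
  have h1 := (contDiff_fderiv_apply (hθ r) (m := 1) (by norm_num) (V q)).differentiable
    (by norm_num) x
  have h2 := (contDiff_fderiv_apply (hθ q) (m := 1) (by norm_num) (V r)).differentiable
    (by norm_num) x
  have h3 : extDer V θ q r = fun y => fderiv ℝ (θ r) y (V q) - fderiv ℝ (θ q) y (V r) := rfl
  rw [h3, fderiv_fun_sub h1 h2, sub_apply,
    fderiv_fderiv_apply (hθ r).contDiffAt, fderiv_fderiv_apply (hθ q).contDiffAt]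

/-- This expresses that a product of closed forms is closed. By Leibniz each term carries a second
derivative of some `θ b`, symmetric in two of its slots, and the alternating sum over the exchange
of those slots vanishes. -/
theorem sum_sign_fderiv_prod_extDer (V : Fin l × Fin 2 → E) {θ : Fin l → Fin l × Fin 2 → E → ℝ}
    (hθ : ∀ a p, ContDiff ℝ 2 (θ a p)) (a₀ : Fin l) (ε δ : Fin 2) (hεδ : ε ≠ δ)
    (c : Fin l × Fin 2 → ℝ) (x : E) :
    ∑ σ : Equiv.Perm (Fin l × Fin 2), ((Equiv.Perm.sign σ : ℤ) : ℝ) * (c (σ (a₀, δ)) *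
      fderiv ℝ (fun y => ∏ a ∈ Finset.univ.erase a₀, extDer V (θ a) (σ (a, 0)) (σ (a, 1)) y) x
        (V (σ (a₀, ε)))) = 0 := by
  have hd : ∀ (σ : Equiv.Perm (Fin l × Fin 2)) v,
      fderiv ℝ (fun y => ∏ a ∈ Finset.univ.erase a₀, extDer V (θ a) (σ (a, 0)) (σ (a, 1)) y) x v
      = ∑ b ∈ Finset.univ.erase a₀, (∏ a ∈ (Finset.univ.erase a₀).erase b,
          extDer V (θ a) (σ (a, 0)) (σ (a, 1)) x) *
          fderiv ℝ (extDer V (θ b) (σ (b, 0)) (σ (b, 1))) x v := by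
    intro σ v
    rw [fderiv_finsetProd (fun a _ =>
      (contDiff_extDer V (hθ a) _ _).differentiable (by norm_num) x)]
    simp
  simp only [hd, Finset.mul_sum]
  rw [Finset.sum_comm]
  refine Finset.sum_eq_zero fun b hb => ?_
  have hb : b ≠ a₀ := Finset.ne_of_mem_erase hb
  have hsym : ∀ p v w, fderiv ℝ (fderiv ℝ (θ b p)) x v w = fderiv ℝ (fderiv ℝ (θ b p)) x w v :=
    fun p v w => (((hθ b p).contDiffAt (x := x)).isSymmSndFDerivAt (by simp)).eq v w
  have hR : ∀ (σ : Equiv.Perm (Fin l × Fin 2)) (κ : Fin 2),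
      ∏ a ∈ (Finset.univ.erase a₀).erase b, extDer V (θ a)
        ((σ * Equiv.swap (a₀, ε) (b, κ)) (a, 0)) ((σ * Equiv.swap (a₀, ε) (b, κ)) (a, 1)) x
      = ∏ a ∈ (Finset.univ.erase a₀).erase b, extDer V (θ a) (σ (a, 0)) (σ (a, 1)) x := by
    intro σ κ
    refine Finset.prod_congr rfl fun a ha => ?_
    have h1 : a ≠ b := Finset.ne_of_mem_erase ha
    have h2 : a ≠ a₀ := Finset.ne_of_mem_erase (Finset.mem_of_mem_erase ha)
    have h3 : ∀ i, Equiv.swap (a₀, ε) (b, κ) (a, i) = (a, i) := fun i =>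
      Equiv.swap_apply_of_ne_of_ne (by simp [h2]) (by simp [h1])
    simp [h3]
  have hc : ∀ (σ : Equiv.Perm (Fin l × Fin 2)) (κ : Fin 2),
      (σ * Equiv.swap (a₀, ε) (b, κ)) (a₀, δ) = σ (a₀, δ) := by
    intro σ κ
    rw [Equiv.Perm.mul_apply,
      Equiv.swap_apply_of_ne_of_ne (by simp [hεδ.symm]) (by simp [hb.symm])]
  have hs : ∀ (σ : Equiv.Perm (Fin l × Fin 2)) (κ : Fin 2),
      (σ * Equiv.swap (a₀, ε) (b, κ)) (a₀, ε) = σ (b, κ) := by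
    intro σ κ
    rw [Equiv.Perm.mul_apply, Equiv.swap_apply_left]
  have ht : ∀ (σ : Equiv.Perm (Fin l × Fin 2)) (κ : Fin 2),
      (σ * Equiv.swap (a₀, ε) (b, κ)) (b, κ) = σ (a₀, ε) := by
    intro σ κ
    rw [Equiv.Perm.mul_apply, Equiv.swap_apply_right]
  have ho : ∀ (σ : Equiv.Perm (Fin l × Fin 2)) (κ κ' : Fin 2), κ ≠ κ' →
      (σ * Equiv.swap (a₀, ε) (b, κ)) (b, κ') = σ (b, κ') := by
    intro σ κ κ' hκ
    rw [Equiv.Perm.mul_apply,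
      Equiv.swap_apply_of_ne_of_ne (by simp [hb]) (by simp [hκ.symm])]
  -- The two second derivatives making up `fderiv_extDer` are killed separately, by exchanging `(a₀,
  -- ε)` with `(b, 0)` and with `(b, 1)`.
  have h1 := sum_sign_mul_eq_zero_of_swap
    (fun σ : Equiv.Perm (Fin l × Fin 2) => c (σ (a₀, δ)) *
      ((∏ a ∈ (Finset.univ.erase a₀).erase b, extDer V (θ a) (σ (a, 0)) (σ (a, 1)) x) *
        fderiv ℝ (fderiv ℝ (θ b (σ (b, 1)))) x (V (σ (a₀, ε))) (V (σ (b, 0)))))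
    (s := (a₀, ε)) (t := (b, 0)) (by simp [hb.symm])
    (fun σ => by
      simp only [hR, hc, hs, ht, ho σ 0 1 (by simp)]
      rw [hsym])
  have h2 := sum_sign_mul_eq_zero_of_swap
    (fun σ : Equiv.Perm (Fin l × Fin 2) => c (σ (a₀, δ)) *
      ((∏ a ∈ (Finset.univ.erase a₀).erase b, extDer V (θ a) (σ (a, 0)) (σ (a, 1)) x) *
        fderiv ℝ (fderiv ℝ (θ b (σ (b, 0)))) x (V (σ (a₀, ε))) (V (σ (b, 1)))))
    (s := (a₀, ε)) (t := (b, 1)) (by simp [hb.symm])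
    (fun σ => by
      simp only [hR, hc, hs, ht, ho σ 1 0 (by simp)]
      rw [hsym])
  rw [← sub_eq_zero.2 (h1.trans h2.symm), ← Finset.sum_sub_distrib]
  refine Finset.sum_congr rfl fun σ _ => ?_
  rw [fderiv_extDer V (hθ b)]
  ring

section Levi

variable [NormedSpace ℂ E]

theorem levi_eq_extDer {ι : Type*} (V : ι → E) {u : E → ℝ} (p q : ι) (x : E) :
    levi u x (V p) (V q)
      = extDer V (fun p y => -fderiv ℝ u y (Complex.I • V p)) p q x := by
  unfold levi extDer
  simp only [fderiv_fun_neg, neg_apply]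
  ring

theorem continuous_levi {u : E → ℝ} (hu : ContDiff ℝ 3 u) (a b : E) :
    Continuous fun x => levi u x a b := by
  unfold levi
  exact (contDiff_fderiv_apply (contDiff_fderiv_apply hu (m := 2) (by norm_num) _) (m := 1)
    (by norm_num) _).continuous.sub
    (contDiff_fderiv_apply (contDiff_fderiv_apply hu (m := 2) (by norm_num) _) (m := 1)
    (by norm_num) _).continuous

theorem continuous_wedgePow_levi {u : E → ℝ} (hu : ContDiff ℝ 3 u) (V : Fin l × Fin 2 → E) :
    Continuous fun x => wedgePow (levi u x) l V := by
  unfold wedgePow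
  exact continuous_const.mul (continuous_finsetSum _ fun σ _ => continuous_const.mul
    (continuous_finsetProd _ fun a _ => continuous_levi hu _ _))

end Levi

variable [FiniteDimensional ℝ E] [MeasurableSpace E] [BorelSpace E]
  (μ : Measure E) [μ.IsAddHaarMeasure]

/-- Stokes' theorem for a product of exact `2`-forms, one of which has a compactly supported
primitive. -/
theorem integral_sum_sign_prod_extDer (V : Fin l × Fin 2 → E)
    {θ : Fin l → Fin l × Fin 2 → E → ℝ} (hθ : ∀ a p, ContDiff ℝ 2 (θ a p)) (a₀ : Fin l)
    (hc : ∀ p, HasCompactSupport (θ a₀ p)) :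
    ∫ x, ∑ σ : Equiv.Perm (Fin l × Fin 2), ((Equiv.Perm.sign σ : ℤ) : ℝ) *
      ∏ a : Fin l, extDer V (θ a) (σ (a, 0)) (σ (a, 1)) x ∂μ = 0 := by
  set g : Equiv.Perm (Fin l × Fin 2) → E → ℝ := fun σ y =>
    ∏ a ∈ Finset.univ.erase a₀, extDer V (θ a) (σ (a, 0)) (σ (a, 1)) y with hg
  have hgC : ∀ σ, ContDiff ℝ 1 (g σ) := fun σ =>
    contDiff_prod fun a _ => contDiff_extDer V (hθ a) _ _
  have hI1 : ∀ σ p q, Integrable (fun x => fderiv ℝ (θ a₀ p) x (V q) * g σ x) μ := by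
    intro σ p q
    refine Continuous.integrable_of_hasCompactSupport ?_ ?_
    · exact (contDiff_fderiv_apply (hθ a₀ p) (m := 0) (by norm_num) _).continuous.mul
        (hgC σ).continuous
    · exact ((hc p).fderiv_apply ℝ (V q)).mul_right
  have hI2 : ∀ σ p q, Integrable (fun x => θ a₀ p x * fderiv ℝ (g σ) x (V q)) μ := by
    intro σ p q
    refine Continuous.integrable_of_hasCompactSupport ?_ ?_
    · exact (hθ a₀ p).continuous.mul
        (contDiff_fderiv_apply (hgC σ) (m := 0) (by norm_num) _).continuous
    · exact (hc p).mul_right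
  have hI3 : ∀ σ p, Integrable (fun x => θ a₀ p x * g σ x) μ := by
    intro σ p
    refine Continuous.integrable_of_hasCompactSupport ?_ ?_
    · exact (hθ a₀ p).continuous.mul (hgC σ).continuous
    · exact (hc p).mul_right
  -- Integration by parts, without boundary term since `θ a₀` has compact support, moves the
  -- derivative onto the other factors.
  have hibp : ∀ σ p q, ∫ x, fderiv ℝ (θ a₀ p) x (V q) * g σ x ∂μ
      = - ∫ x, θ a₀ p x * fderiv ℝ (g σ) x (V q) ∂μ := by
    intro σ p q
    rw [integral_mul_fderiv_eq_neg_fderiv_mul_of_integrable (hI1 σ p q) (hI2 σ p q) (hI3 σ p)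
      (fun x _ => (hθ a₀ p).differentiable (by norm_num) x)
      (fun x _ => (hgC σ).differentiable (by norm_num) x), neg_neg]
  have hsplit : ∀ x, (∑ σ : Equiv.Perm (Fin l × Fin 2), ((Equiv.Perm.sign σ : ℤ) : ℝ) *
      ∏ a : Fin l, extDer V (θ a) (σ (a, 0)) (σ (a, 1)) x)
      = ∑ σ : Equiv.Perm (Fin l × Fin 2), ((Equiv.Perm.sign σ : ℤ) : ℝ) *
        (fderiv ℝ (θ a₀ (σ (a₀, 1))) x (V (σ (a₀, 0))) * g σ x
          - fderiv ℝ (θ a₀ (σ (a₀, 0))) x (V (σ (a₀, 1))) * g σ x) := by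
    intro x
    refine Finset.sum_congr rfl fun σ _ => ?_
    rw [← Finset.mul_prod_erase Finset.univ _ (Finset.mem_univ a₀)]
    simp only [hg, extDer]
    ring
  have hzero : ∀ ε δ : Fin 2, ε ≠ δ → ∑ σ : Equiv.Perm (Fin l × Fin 2),
      ((Equiv.Perm.sign σ : ℤ) : ℝ) *
        ∫ x, fderiv ℝ (θ a₀ (σ (a₀, δ))) x (V (σ (a₀, ε))) * g σ x ∂μ = 0 := by
    intro ε δ hεδ
    simp only [hibp, mul_neg, Finset.sum_neg_distrib, neg_eq_zero, ← integral_const_mul]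
    rw [← integral_finsetSum _ (fun σ _ => (hI2 σ _ _).const_mul _)]
    refine integral_eq_zero_of_ae (Eventually.of_forall fun x => ?_)
    exact sum_sign_fderiv_prod_extDer V hθ a₀ ε δ hεδ (fun p => θ a₀ p x) x
  simp only [hsplit]
  have hI4 : ∀ σ : Equiv.Perm (Fin l × Fin 2), Integrable (fun x =>
      ((Equiv.Perm.sign σ : ℤ) : ℝ) *
        (fderiv ℝ (θ a₀ (σ (a₀, 1))) x (V (σ (a₀, 0))) * g σ x
          - fderiv ℝ (θ a₀ (σ (a₀, 0))) x (V (σ (a₀, 1))) * g σ x)) μ :=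
    fun σ => ((hI1 σ _ _).sub (hI1 σ _ _)).const_mul _
  rw [integral_finsetSum _ (fun σ _ => hI4 σ)]
  have h1 := hzero 0 1 (by simp)
  have h2 := hzero 1 0 (by simp)
  rw [← sub_eq_zero.2 (h1.trans h2.symm), ← Finset.sum_sub_distrib]
  refine Finset.sum_congr rfl fun σ _ => ?_
  rw [integral_const_mul, integral_sub (hI1 σ _ _) (hI1 σ _ _), mul_sub]

/-- Expanding `(dd^c φ + dd^c w)^l` over the sets `S` of slots occupied by `φ`, every term other
than `S = univ` has a factor `dd^c w`. Its primitive is compactly supported, so Stokes applies. -/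
theorem integral_wedgePow_levi_sub [NormedSpace ℂ E] {φ w : E → ℝ} (hφ : ContDiff ℝ 3 φ) (hw : ContDiff ℝ 3 w)
    (hwc : HasCompactSupport w) (V : Fin l × Fin 2 → E) :
    ∫ x, (wedgePow (levi (fun y => φ y + w y) x) l V - wedgePow (levi φ x) l V) ∂μ = 0 := by
  set θ : (E → ℝ) → Fin l × Fin 2 → E → ℝ :=
    fun u p y => -fderiv ℝ u y (Complex.I • V p) with hθ
  have hC : ∀ u, ContDiff ℝ 3 u → ∀ p, ContDiff ℝ 2 (θ u p) := fun u hu p =>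
    (contDiff_fderiv_apply hu (by norm_num) _).neg
  have hcs : ∀ p, HasCompactSupport (θ w p) := fun p => (hwc.fderiv_apply ℝ _).neg
  set ψ : Finset (Fin l) → Fin l → E → ℝ := fun S a => if a ∈ S then φ else w with hψ
  have hψC : ∀ S a, ContDiff ℝ 3 (ψ S a) := by
    intro S a
    simp only [hψ]
    split_ifs
    · exact hφ
    · exact hw
  have hexp : ∀ x, wedgePow (levi (fun y => φ y + w y) x) l V - wedgePow (levi φ x) l V
      = ((2 : ℝ) ^ l)⁻¹ * ∑ S ∈ Finset.univ.powerset.erase (Finset.univ : Finset (Fin l)),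
        ∑ σ : Equiv.Perm (Fin l × Fin 2), ((Equiv.Perm.sign σ : ℤ) : ℝ) *
        ∏ a : Fin l, extDer V (θ (ψ S a)) (σ (a, 0)) (σ (a, 1)) x := by
    intro x
    unfold wedgePow
    rw [← mul_sub]
    congr 1
    have hprod : ∀ (S : Finset (Fin l)) (σ : Equiv.Perm (Fin l × Fin 2)),
        ∏ a : Fin l, extDer V (θ (ψ S a)) (σ (a, 0)) (σ (a, 1)) x
        = (∏ a ∈ S, levi φ x (V (σ (a, 0))) (V (σ (a, 1))))
          * ∏ a ∈ Finset.univ \ S, levi w x (V (σ (a, 0))) (V (σ (a, 1))) := by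
      intro S σ
      rw [← Finset.prod_sdiff (Finset.subset_univ S), mul_comm]
      congr 1
      · refine Finset.prod_congr rfl fun a ha => ?_
        rw [levi_eq_extDer]
        simp [hψ, ha, hθ]
      · refine Finset.prod_congr rfl fun a ha => ?_
        rw [levi_eq_extDer]
        simp [hψ, (Finset.mem_sdiff.1 ha).2, hθ]
    have h1 : ∀ σ : Equiv.Perm (Fin l × Fin 2),
        ∏ a : Fin l, levi (fun y => φ y + w y) x (V (σ (a, 0))) (V (σ (a, 1)))
        = ∑ S ∈ Finset.univ.powerset,
          ∏ a : Fin l, extDer V (θ (ψ S a)) (σ (a, 0)) (σ (a, 1)) x := by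
      intro σ
      simp only [hprod]
      rw [← Finset.prod_add]
      refine Finset.prod_congr rfl fun a _ => ?_
      exact levi_add (hφ.contDiffAt.of_le (by norm_num)) (hw.contDiffAt.of_le (by norm_num)) _ _
    have h2 : ∀ σ : Equiv.Perm (Fin l × Fin 2),
        ∏ a : Fin l, levi φ x (V (σ (a, 0))) (V (σ (a, 1)))
        = ∏ a : Fin l, extDer V (θ (ψ Finset.univ a)) (σ (a, 0)) (σ (a, 1)) x := by
      intro σ
      rw [hprod]
      simp
    rw [Finset.sum_comm, ← Finset.sum_sub_distrib]
    refine Finset.sum_congr rfl fun σ _ => ?_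
    rw [h1, h2, ← Finset.mul_sum, ← mul_sub,
      ← Finset.add_sum_erase _ _ (Finset.mem_powerset_self (Finset.univ : Finset (Fin l)))]
    ring
  simp only [hexp]
  rw [integral_const_mul, integral_finsetSum, Finset.sum_eq_zero, mul_zero]
  · intro S hS
    have hS' : S ≠ Finset.univ := Finset.ne_of_mem_erase hS
    obtain ⟨a₀, ha₀⟩ : ∃ a, a ∉ S := by
      by_contra! h
      exact hS' (Finset.eq_univ_iff_forall.2 h)
    refine integral_sum_sign_prod_extDer μ V (θ := fun a => θ (ψ S a))
      (fun a p => hC _ (hψC S a) p) a₀ fun p => ?_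
    simp only [hψ, ha₀, if_false]
    exact hcs p
  · intro S hS
    have hS' : S ≠ Finset.univ := Finset.ne_of_mem_erase hS
    obtain ⟨a₀, ha₀⟩ : ∃ a, a ∉ S := by
      by_contra! h
      exact hS' (Finset.eq_univ_iff_forall.2 h)
    refine integrable_finsetSum _ fun σ _ => Integrable.const_mul ?_ _
    refine Continuous.integrable_of_hasCompactSupport ?_ ?_
    · exact continuous_finsetProd _ fun a _ =>
        (contDiff_extDer V (hC _ (hψC S a)) _ _).continuous
    · have h0 : HasCompactSupport (extDer V (θ w) (σ (a₀, 0)) (σ (a₀, 1))) :=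
        ((hcs _).fderiv_apply ℝ _).sub ((hcs _).fderiv_apply ℝ _)
      have h1 : (fun x => ∏ a : Fin l, extDer V (θ (ψ S a)) (σ (a, 0)) (σ (a, 1)) x)
          = fun x => extDer V (θ w) (σ (a₀, 0)) (σ (a₀, 1)) x *
            ∏ a ∈ Finset.univ.erase a₀, extDer V (θ (ψ S a)) (σ (a, 0)) (σ (a, 1)) x := by
        ext x
        rw [← Finset.mul_prod_erase Finset.univ _ (Finset.mem_univ a₀)]
        simp [hψ, ha₀]
      rw [h1]
      exact h0.mul_right

end Stokes

/-! ### The gluing functions and the Chern–Levine–Nirenberg inequality -/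

/-- A smooth convex function which vanishes on `(-∞, 0]` and has slope `1` on `[1, ∞)`. -/
def smoothRamp (t : ℝ) : ℝ := ∫ s in (0 : ℝ)..t, Real.smoothTransition s

theorem hasDerivAt_smoothRamp (t : ℝ) : HasDerivAt smoothRamp (Real.smoothTransition t) t :=
  intervalIntegral.integral_hasDerivAt_right
    (Real.smoothTransition.continuous.intervalIntegrable _ _)
    (Real.smoothTransition.continuous.stronglyMeasurableAtFilter _ _)
    Real.smoothTransition.continuous.continuousAt

theorem deriv_smoothRamp : deriv smoothRamp = Real.smoothTransition :=
  funext fun t => (hasDerivAt_smoothRamp t).deriv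

theorem contDiff_smoothRamp : ContDiff ℝ 3 smoothRamp := by
  rw [show (3 : WithTop ℕ∞) = 2 + 1 by norm_num, contDiff_succ_iff_deriv]
  refine ⟨fun t => (hasDerivAt_smoothRamp t).differentiableAt, by simp, ?_⟩
  rw [deriv_smoothRamp]
  exact Real.smoothTransition.contDiff (n := 2)

theorem smoothRamp_of_nonpos {t : ℝ} (ht : t ≤ 0) : smoothRamp t = 0 := by
  unfold smoothRamp
  rw [intervalIntegral.integral_congr (g := fun _ => 0)]
  · simp
  · intro s hs
    rw [Set.uIcc_of_ge ht] at hs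
    exact Real.smoothTransition.zero_of_nonpos hs.2

theorem smoothRamp_of_one_le {t : ℝ} (ht : 1 ≤ t) : smoothRamp t = t + (smoothRamp 1 - 1) := by
  have h : smoothRamp t = smoothRamp 1 + ∫ s in (1 : ℝ)..t, Real.smoothTransition s :=
    (intervalIntegral.integral_add_adjacent_intervals
      (Real.smoothTransition.continuous.intervalIntegrable _ _)
      (Real.smoothTransition.continuous.intervalIntegrable _ _)).symm
  have h2 : ∫ s in (1 : ℝ)..t, Real.smoothTransition s = ∫ s in (1 : ℝ)..t, (1 : ℝ) := by
    refine intervalIntegral.integral_congr fun s hs => ?_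
    rw [Set.uIcc_of_le ht] at hs
    exact Real.smoothTransition.one_of_one_le hs.1
  rw [h, h2]
  simp
  ring

theorem deriv_deriv_smoothRamp_nonneg (t : ℝ) : 0 ≤ deriv (deriv smoothRamp) t := by
  rw [deriv_smoothRamp]
  exact Real.smoothTransition.monotone.deriv_nonneg

theorem wedgePow_levi_nonneg {l : ℕ} {u : (Fin l → ℂ) → ℝ} {x : Fin l → ℂ}
    (hu : ContDiffAt ℝ 2 u x) (hpos : ∀ a, 0 ≤ levi u x a (Complex.I • a)) :
    0 ≤ wedgePow (levi u x) l (realFrame l) := by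
  have h := wedgePow_nonneg (leviForm u x)
    (fun a b => by rw [leviForm_apply hu, leviForm_apply hu, levi_antisymm])
    (fun a b => by rw [leviForm_apply hu, leviForm_apply hu, levi_I_smul hu])
    (fun a => by rw [leviForm_apply hu]; exact hpos a)
  simpa only [leviForm_apply hu] using h

/-- The plurisubharmonic function `2 ∑ |z_i|^{2l} - (2 l + 1)`. -/
def barrier (l : ℕ) (z : Fin l → ℂ) : ℝ :=
  2 * ‖(WithLp.toLp 2 fun i => z i ^ l : EuclideanSpace ℂ (Fin l))‖ ^ 2 + -(2 * l + 1 : ℝ)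

theorem contDiff_toLp_pow (l : ℕ) : ContDiff ℂ 3
    (fun z : Fin l → ℂ => (WithLp.toLp 2 fun i => z i ^ l : EuclideanSpace ℂ (Fin l))) := by
  rw [contDiff_euclidean]
  intro i
  exact (contDiff_apply ℂ ℂ i).pow l

theorem contDiff_barrier (l : ℕ) : ContDiff ℝ 3 (barrier l) := by
  refine contDiff_iff_contDiffAt.2 fun x => ?_
  exact (contDiffAt_const.mul
    (contDiffAt_normSq_comp ((contDiff_toLp_pow l).contDiffAt))).add contDiffAt_const

theorem levi_barrier_nonneg (l : ℕ) (x a : Fin l → ℂ) :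
    0 ≤ levi (barrier l) x a (Complex.I • a) := by
  have hG := ((contDiff_toLp_pow l).contDiffAt (x := x)).of_le (m := 2) (by norm_num)
  have h : levi (barrier l) x a (Complex.I • a) = _ := levi_add_const
    (fun z : Fin l → ℂ =>
      2 * ‖(WithLp.toLp 2 fun i => z i ^ l : EuclideanSpace ℂ (Fin l))‖ ^ 2) _ x a _
  rw [h, levi_const_mul (contDiffAt_normSq_comp hG), levi_normSq hG, map_smul, inner_smul_right,
    Complex.I_mul_im]
  exact mul_nonneg (by norm_num) (mul_nonneg (by norm_num) (inner_self_nonneg (𝕜 := ℂ)))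

theorem barrier_eq (l : ℕ) (z : Fin l → ℂ) :
    barrier l z = 2 * ∑ i, ‖z i‖ ^ (2 * l) - (2 * l + 1) := by
  unfold barrier
  rw [EuclideanSpace.norm_sq_eq]
  simp only [norm_pow, ← pow_mul, mul_comm l 2]
  ring

theorem barrier_le {l : ℕ} {z : Fin l → ℂ} (hz : ‖z‖ ≤ 1) : barrier l z ≤ -1 := by
  rw [barrier_eq]
  have : ∑ i, ‖z i‖ ^ (2 * l) ≤ ∑ _i : Fin l, (1 : ℝ) :=
    Finset.sum_le_sum fun i _ => pow_le_one₀ (norm_nonneg _) ((norm_le_pi_norm z i).trans hz)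
  simp at this
  linarith

/-- Since `(3/2)² ≥ 2`, one coordinate of modulus at least `3/2` already contributes `2^l ≥ l + 1`.
The exponent `2l` grows with `l` because on the unit polydisc the sum can approach `l`. -/
theorem le_barrier {l : ℕ} {z : Fin l → ℂ} (hz : 3 / 2 ≤ ‖z‖) : 1 ≤ barrier l z := by
  rw [barrier_eq]
  obtain ⟨i, hi⟩ : ∃ i, 3 / 2 ≤ ‖z i‖ := by
    by_contra! h
    exact absurd ((pi_norm_lt_iff (by norm_num)).2 h) (not_lt.2 hz)
  have h1 : (l + 1 : ℝ) ≤ 2 ^ l := by exact_mod_cast Nat.lt_two_pow_self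
  have h2 : (2 : ℝ) ^ l ≤ ‖z i‖ ^ (2 * l) := by
    rw [pow_mul]
    exact pow_le_pow_left₀ (by norm_num) (by nlinarith) _
  have h3 : ‖z i‖ ^ (2 * l) ≤ ∑ i, ‖z i‖ ^ (2 * l) :=
    Finset.single_le_sum (f := fun i => ‖z i‖ ^ (2 * l)) (fun _ _ => by positivity)
      (Finset.mem_univ i)
  linarith

/-- Convex gluing preserves plurisubharmonicity. -/
theorem levi_add_smoothRamp_nonneg {E : Type*} [NormedAddCommGroup E] [NormedSpace ℝ E]
    [NormedSpace ℂ E] {u φ : E → ℝ} {x : E} (hu : ContDiffAt ℝ 2 u x) (hφ : ContDiffAt ℝ 2 φ x)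
    {a : E} (hua : 0 ≤ levi u x a (Complex.I • a)) (hφa : 0 ≤ levi φ x a (Complex.I • a)) :
    0 ≤ levi (fun y => φ y + smoothRamp (u y + (-1) * φ y)) x a (Complex.I • a) := by
  have hφ' : ContDiffAt ℝ 2 (fun y => (-1) * φ y) x := contDiffAt_const.mul hφ
  have ht : ContDiffAt ℝ 2 (fun y => u y + (-1) * φ y) x := hu.add hφ'
  have hr : ∀ s, ContDiffAt ℝ 2 smoothRamp s :=
    fun s => (contDiff_smoothRamp.of_le (by norm_num)).contDiffAt
  have hII : Complex.I • Complex.I • a = -a := by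
    rw [smul_smul, Complex.I_mul_I, neg_one_smul]
  have hrt : ContDiffAt ℝ 2 (fun y => smoothRamp (u y + (-1) * φ y)) x := (hr _).comp x ht
  -- With `r = smoothRamp` and `t = u - φ`, the form becomes `(1 - r'(t)) dd^c φ + r'(t) dd^c u`
  -- plus `r''(t)` times a sum of squares, where `0 ≤ r' ≤ 1` and `r'' ≥ 0`.
  rw [levi_add hφ hrt, levi_comp ht (hr _), levi_add hu hφ', levi_const_mul hφ, hII,
    map_neg, deriv_smoothRamp]
  have h0 := Real.smoothTransition.nonneg (u x + (-1) * φ x)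
  have h1 := Real.smoothTransition.le_one (u x + (-1) * φ x)
  have h2 := deriv_deriv_smoothRamp_nonneg (u x + (-1) * φ x)
  rw [deriv_smoothRamp] at h2
  set L := fderiv ℝ (fun y => u y + (-1) * φ y) x
  have h3 : 0 ≤ L (Complex.I • a) * L (Complex.I • a) - L a * -L a := by
    nlinarith [mul_self_nonneg (L (Complex.I • a)), mul_self_nonneg (L a)]
  nlinarith [mul_nonneg h2 h3, mul_nonneg h0 hua, mul_nonneg (sub_nonneg.2 h1) hφa]

/-- The Chern–Levine–Nirenberg inequality for smooth plurisubharmonic functions on a polydisc. -/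
theorem exists_integral_wedgePow_levi_le (l : ℕ) : ∃ C : ℝ, 0 < C ∧
    ∀ u : (Fin l → ℂ) → ℝ, ContDiffOn ℝ 3 u (Metric.ball 0 2) →
      (∀ x ∈ Metric.ball (0 : Fin l → ℂ) 2, 0 ≤ u x ∧ u x ≤ 1) →
      (∀ x ∈ Metric.ball (0 : Fin l → ℂ) 2, ∀ a, 0 ≤ levi u x a (Complex.I • a)) →
      IntegrableOn (fun x => wedgePow (levi u x) l (realFrame l)) (Metric.ball 0 1) ∧
      ∫ x in Metric.ball 0 1, wedgePow (levi u x) l (realFrame l) ≤ C := by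
  set φ := barrier l with hφ
  have hφC : ContDiff ℝ 3 φ := contDiff_barrier l
  set K : Set (Fin l → ℂ) := Metric.closedBall 0 (3 / 2) with hK
  have hKc : IsCompact K := isCompact_closedBall _ _
  have hφpos : ∀ x, 0 ≤ wedgePow (levi φ x) l (realFrame l) := fun x =>
    wedgePow_levi_nonneg (hφC.contDiffAt.of_le (by norm_num)) fun a => levi_barrier_nonneg l x a
  -- The constant is the mass of the barrier on `K`; the added `1` only makes it strictly positive.
  refine ⟨(∫ x in K, wedgePow (levi φ x) l (realFrame l)) + 1,
    add_pos_of_nonneg_of_pos (integral_nonneg hφpos) one_pos, fun u hu hu01 hupos => ?_⟩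
  set t : (Fin l → ℂ) → ℝ := fun y => u y + (-1) * φ y with ht
  -- Where `‖x‖ > 3/2`, `u ≤ 1 ≤ φ` makes the argument of the ramp nonpositive, so the extension by
  -- zero is smooth and supported in `K`.
  set w : (Fin l → ℂ) → ℝ := (Metric.ball 0 2).indicator fun y => smoothRamp (t y) with hw
  have huAt : ∀ x ∈ Metric.ball (0 : Fin l → ℂ) 2, ContDiffAt ℝ 3 u x := fun x hx =>
    hu.contDiffAt (Metric.isOpen_ball.mem_nhds hx)
  have hw0 : ∀ x, 3 / 2 < ‖x‖ → w x = 0 := by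
    intro x hx
    by_cases h2 : x ∈ Metric.ball (0 : Fin l → ℂ) 2
    · rw [hw, Set.indicator_of_mem h2]
      refine smoothRamp_of_nonpos ?_
      have := (hu01 x h2).2
      have := le_barrier hx.le
      simp only [ht]
      linarith
    · rw [hw, Set.indicator_of_notMem h2]
  have hwin : ∀ x ∈ Metric.ball (0 : Fin l → ℂ) 2, w =ᶠ[𝓝 x] fun y => smoothRamp (t y) := by
    intro x hx
    filter_upwards [Metric.isOpen_ball.mem_nhds hx] with y hy
    rw [hw, Set.indicator_of_mem hy]
  have hwout : ∀ x, x ∉ K → w =ᶠ[𝓝 x] fun _ => 0 := by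
    intro x hx
    filter_upwards [Metric.isClosed_closedBall.isOpen_compl.mem_nhds hx] with y hy
    refine hw0 y ?_
    simpa using hy
  have hKball : K ⊆ Metric.ball 0 2 := Metric.closedBall_subset_ball (by norm_num)
  have hwC : ContDiff ℝ 3 w := by
    refine contDiff_iff_contDiffAt.2 fun x => ?_
    by_cases hx : x ∈ K
    · refine ContDiffAt.congr_of_eventuallyEq ?_ (hwin x (hKball hx))
      exact contDiff_smoothRamp.contDiffAt.comp x
        ((huAt x (hKball hx)).add (contDiffAt_const.mul hφC.contDiffAt))
    · exact contDiffAt_const.congr_of_eventuallyEq (hwout x hx)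
  have hwc : HasCompactSupport w := by
    refine HasCompactSupport.intro hKc fun x hx => ?_
    refine hw0 x ?_
    simpa [hK] using hx
  set v : (Fin l → ℂ) → ℝ := fun y => φ y + w y with hv
  have hvC : ContDiff ℝ 3 v := hφC.add hwC
  have hvpos : ∀ x, 0 ≤ wedgePow (levi v x) l (realFrame l) := by
    intro x
    refine wedgePow_levi_nonneg (hvC.contDiffAt.of_le (by norm_num)) fun a => ?_
    by_cases hx : x ∈ K
    · have h1 : v =ᶠ[𝓝 x] fun y => φ y + smoothRamp (t y) :=
        (hwin x (hKball hx)).mono fun y hy => by simp only [hv, hy]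
      rw [levi_congr h1]
      exact levi_add_smoothRamp_nonneg ((huAt x (hKball hx)).of_le (by norm_num))
        (hφC.contDiffAt.of_le (by norm_num)) (hupos x (hKball hx) a) (levi_barrier_nonneg l x a)
    · have h1 : v =ᶠ[𝓝 x] φ := (hwout x hx).mono fun y hy => by simp only [hv, hy, add_zero]
      rw [levi_congr h1]
      exact levi_barrier_nonneg l x a
  have hvu : ∀ x ∈ Metric.ball (0 : Fin l → ℂ) 1, levi v x = levi u x := by
    intro x hx
    -- On the unit polydisc `φ ≤ -1` and `u ≥ 0`, so `u - φ ≥ 1` lies where the ramp has slope `1`,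
    -- and `φ` cancels.
    have h1 : v =ᶠ[𝓝 x] fun y => u y + (smoothRamp 1 - 1) := by
      filter_upwards [Metric.isOpen_ball.mem_nhds hx] with y hy
      have hy2 : y ∈ Metric.ball (0 : Fin l → ℂ) 2 :=
        Metric.ball_subset_ball (by norm_num) hy
      have h2 : barrier l y ≤ -1 := barrier_le (by simpa using (mem_ball_zero_iff.1 hy).le)
      have h3 := (hu01 y hy2).1
      simp only [hv, hw, Set.indicator_of_mem hy2]
      rw [smoothRamp_of_one_le (by simp only [ht]; linarith)]
      simp only [ht]
      ring
    ext a b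
    rw [levi_congr h1, levi_add_const]
  have hcontv := continuous_wedgePow_levi hvC (realFrame l)
  have hcontφ := continuous_wedgePow_levi hφC (realFrame l)
  have hivK := hcontv.continuousOn.integrableOn_compact (μ := volume) hKc
  have hiφK := hcontφ.continuousOn.integrableOn_compact (μ := volume) hKc
  have hsub : Metric.ball (0 : Fin l → ℂ) 1 ⊆ K :=
    (Metric.ball_subset_closedBall).trans (Metric.closedBall_subset_closedBall (by norm_num))
  have hEq : Set.EqOn (fun x => wedgePow (levi v x) l (realFrame l))
      (fun x => wedgePow (levi u x) l (realFrame l)) (Metric.ball 0 1) := fun x hx => by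
    simp only [hvu x hx]
  refine ⟨(hivK.mono_set hsub).congr_fun hEq measurableSet_ball, ?_⟩
  rw [← setIntegral_congr_fun measurableSet_ball hEq]
  -- Positivity of the density of `v` permits enlarging the domain to `K`, where Stokes compares it
  -- with `φ`.
  have h1 : ∫ x in Metric.ball 0 1, wedgePow (levi v x) l (realFrame l)
      ≤ ∫ x in K, wedgePow (levi v x) l (realFrame l) :=
    setIntegral_mono_set hivK (Eventually.of_forall hvpos) hsub.eventuallyLE
  have h2 : ∫ x in K, (wedgePow (levi v x) l (realFrame l) - wedgePow (levi φ x) l (realFrame l))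
      = 0 := by
    rw [setIntegral_eq_integral_of_forall_compl_eq_zero]
    · exact integral_wedgePow_levi_sub volume hφC hwC hwc _
    · intro x hx
      have h1 : v =ᶠ[𝓝 x] φ := (hwout x hx).mono fun y hy => by simp only [hv, hy, add_zero]
      have h3 : levi v x = levi φ x := by
        ext a b
        exact levi_congr h1 a b
      rw [h3, sub_self]
  rw [integral_sub hivK hiφK] at h2
  linarith

/-! ### Smoothness of holomorphic maps of several variables -/

section Osgood

variable {E F : Type*} [NormedAddCommGroup E] [NormedSpace ℂ E] [FiniteDimensional ℂ E]
  [NormedAddCommGroup F] [NormedSpace ℂ F] [FiniteDimensional ℂ F]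

/-- Near `x₀`, Cauchy's formula on a small circle in the direction `v` writes the directional
derivative as an integral of values of `f`, which may be differentiated under the integral sign. -/
theorem differentiableOn_fderiv_apply {f : E → F} {U : Set E}
    (hf : DifferentiableOn ℂ f U) (hU : IsOpen U) (v : E) :
    DifferentiableOn ℂ (fun x => fderiv ℂ f x v) U := by
  intro x₀ hx₀
  have : CompleteSpace F := FiniteDimensional.complete ℂ F
  have : ProperSpace E := FiniteDimensional.proper ℂ E
  have : ProperSpace (E →L[ℂ] F) := FiniteDimensional.proper ℂ _
  have : SecondCountableTopology (E →L[ℂ] F) := secondCountable_of_proper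
  borelize E
  borelize (E →L[ℂ] F)
  obtain ⟨s, hs, hsU⟩ : ∃ s > 0, Metric.ball x₀ s ⊆ U ∩ f ⁻¹' Metric.ball (f x₀) 1 := by
    refine Metric.mem_nhds_iff.1 (inter_mem (hU.mem_nhds hx₀) ?_)
    exact (hf.continuousOn.continuousAt (hU.mem_nhds hx₀)) (Metric.ball_mem_nhds _ one_pos)
  obtain ⟨r, hr, hrs⟩ : ∃ r > 0, 3 * r = s := ⟨s / 3, by positivity, by ring⟩
  -- Cauchy estimate: any two values of `f` on the ball of radius `s = 3r` differ by less than `2`.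
  -- This gives the dominating function below.
  have hb : ∀ y ∈ Metric.ball x₀ (2 * r), ‖fderiv ℂ f y‖ ≤ 2 / r := by
    intro y hy
    have hsub : Metric.ball y r ⊆ Metric.ball x₀ s := by
      refine Metric.ball_subset_ball' ?_
      have := Metric.mem_ball.1 hy
      linarith
    refine Complex.norm_fderiv_le_div_of_mapsTo_ball
      (hf.mono (hsub.trans (hsU.trans Set.inter_subset_left))) (fun z hz => ?_) hr
    have h1 : dist (f z) (f x₀) < 1 := (hsU (hsub hz)).2
    have h2 : dist (f y) (f x₀) < 1 := (hsU (hsub (Metric.mem_ball_self hr))).2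
    rw [Metric.mem_closedBall]
    linarith [dist_triangle_right (f z) (f y) (f x₀)]
  -- The radius `ρ` keeps the circles `x + ζ v`, for `x` within `r` of `x₀`, inside the ball where
  -- the estimate holds.
  obtain ⟨ρ, hρ, hρv⟩ : ∃ ρ > 0, ρ * ‖v‖ ≤ r := by
    refine ⟨r / (‖v‖ + 1), by positivity, ?_⟩
    rw [div_mul_eq_mul_div, div_le_iff₀ (by positivity)]
    nlinarith [norm_nonneg v]
  have hmem : ∀ x ∈ Metric.ball x₀ r, ∀ ζ : ℂ, ‖ζ‖ ≤ ρ → x + ζ • v ∈ Metric.ball x₀ (2 * r) := by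
    intro x hx ζ hζ
    rw [Metric.mem_ball, dist_eq_norm] at hx ⊢
    have h1 : ‖ζ • v‖ ≤ r := by
      rw [norm_smul]
      exact (mul_le_mul_of_nonneg_right hζ (norm_nonneg v)).trans hρv
    calc ‖x + ζ • v - x₀‖ = ‖(x - x₀) + ζ • v‖ := by congr 1; abel
      _ ≤ ‖x - x₀‖ + ‖ζ • v‖ := norm_add_le _ _
      _ < 2 * r := by linarith
  have hU2 : Metric.ball x₀ (2 * r) ⊆ U :=
    (Metric.ball_subset_ball (by linarith)).trans (hsU.trans Set.inter_subset_left)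
  have hfd : ∀ y ∈ Metric.ball x₀ (2 * r), DifferentiableAt ℂ f y := fun y hy =>
    hf.differentiableAt (hU.mem_nhds (hU2 hy))
  set c : ℝ → ℂ := fun θ => deriv (circleMap 0 ρ) θ * (1 / (circleMap 0 ρ θ - 0) ^ 2) with hc
  have hcc : Continuous c := by
    have h0 : ∀ θ, (circleMap 0 ρ θ - 0) ^ 2 ≠ 0 := fun θ => by
      simpa using hρ.ne'
    simp only [hc, deriv_circleMap]
    exact ((continuous_circleMap 0 ρ).mul continuous_const).mul
      (continuous_const.div (((continuous_circleMap 0 ρ).sub continuous_const).pow 2) h0)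
  have hcirc : ∀ θ, ‖circleMap 0 ρ θ‖ ≤ ρ := fun θ => by
    simp [abs_of_pos hρ]
  have hrep : ∀ x ∈ Metric.ball x₀ r, fderiv ℂ f x v
      = (2 * Real.pi * Complex.I : ℂ)⁻¹ •
        ∫ θ in (0 : ℝ)..2 * Real.pi, c θ • f (x + circleMap 0 ρ θ • v) := by
    intro x hx
    have hline : ∀ ζ : ℂ, HasDerivAt (fun ζ : ℂ => x + ζ • v) v ζ := fun ζ => by
      simpa using ((hasDerivAt_id ζ).smul_const v).const_add x
    have hd : DifferentiableOn ℂ (fun ζ : ℂ => f (x + ζ • v)) (Metric.closedBall 0 ρ) := by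
      intro ζ hζ
      have h1 := hfd _ (hmem x hx ζ (by simpa using hζ))
      exact (h1.comp ζ (hline ζ).differentiableAt).differentiableWithinAt
    have h1 := hd.deriv_eq_smul_circleIntegral hρ
    have h2 : deriv (fun ζ : ℂ => f (x + ζ • v)) 0 = fderiv ℂ f x v := by
      have h3 := hfd _ (hmem x hx 0 (by simpa using hρ.le))
      have h4 := (h3.hasFDerivAt.comp_hasDerivAt (0 : ℂ) (hline 0)).deriv
      simp only [zero_smul, add_zero] at h4
      exact h4
    rw [h2] at h1
    have h5 : (2 * Real.pi * Complex.I : ℂ) ≠ 0 := Complex.two_pi_I_ne_zero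
    rw [eq_inv_smul_iff₀ h5, ← h1, circleIntegral]
    simp only [hc, mul_smul]
  have hcontF : ∀ x ∈ Metric.ball x₀ r,
      Continuous fun θ : ℝ => c θ • f (x + circleMap 0 ρ θ • v) := by
    intro x hx
    refine hcc.smul (continuous_iff_continuousAt.2 fun θ => ?_)
    refine ContinuousAt.comp (f := fun θ : ℝ => x + circleMap 0 ρ θ • v) (g := f)
      (hfd _ (hmem x hx _ (hcirc θ))).continuousAt ?_
    exact (continuous_const.add ((continuous_circleMap 0 ρ).smul continuous_const)).continuousAt
  have hder := intervalIntegral.hasFDerivAt_integral_of_dominated_of_fderiv_le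
    (𝕜 := ℂ) (μ := volume) (a := 0) (b := 2 * Real.pi)
    (F := fun x θ => c θ • f (x + circleMap 0 ρ θ • v))
    (F' := fun x θ => c θ • fderiv ℂ f (x + circleMap 0 ρ θ • v))
    (bound := fun θ => ‖c θ‖ * (2 / r))
    (Metric.ball_mem_nhds x₀ hr)
    (by
      filter_upwards [Metric.ball_mem_nhds x₀ hr] with x hx
      exact (hcontF x hx).aestronglyMeasurable)
    ((hcontF x₀ (Metric.mem_ball_self hr)).intervalIntegrable _ _)
    (by
      refine hcc.aestronglyMeasurable.smul (Measurable.aestronglyMeasurable ?_)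
      refine (measurable_fderiv ℂ f).comp (Continuous.measurable ?_)
      exact continuous_const.add ((continuous_circleMap 0 ρ).smul continuous_const))
    (by
      refine Eventually.of_forall fun θ _ x hx => ?_
      rw [norm_smul]
      exact mul_le_mul_of_nonneg_left (hb _ (hmem x hx _ (hcirc θ))) (norm_nonneg _))
    ((hcc.norm.mul continuous_const).intervalIntegrable _ _)
    (by
      refine Eventually.of_forall fun θ _ x hx => ?_
      have h1 := (hfd _ (hmem x hx _ (hcirc θ))).hasFDerivAt
      have h2 := h1.comp x ((hasFDerivAt_id x).add_const (circleMap 0 ρ θ • v))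
      rw [ContinuousLinearMap.comp_id] at h2
      exact h2.const_smul (c θ))
  have h6 : (fun x => fderiv ℂ f x v) =ᶠ[𝓝 x₀] fun x => (2 * Real.pi * Complex.I : ℂ)⁻¹ •
        ∫ θ in (0 : ℝ)..2 * Real.pi, c θ • f (x + circleMap 0 ρ θ • v) := by
    filter_upwards [Metric.ball_mem_nhds x₀ hr] with x hx using hrep x hx
  exact ((hder.differentiableAt.const_smul _).congr_of_eventuallyEq h6).differentiableWithinAt

/-- Osgood's lemma: holomorphic maps of several variables are smooth. -/
theorem contDiffOn_of_differentiableOn_complex {f : E → F} {U : Set E}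
    (hf : DifferentiableOn ℂ f U) (hU : IsOpen U) (n : ℕ) : ContDiffOn ℂ n f U := by
  induction n generalizing f with
  | zero => exact contDiffOn_zero.2 hf.continuousOn
  | succ n ih =>
    push_cast
    rw [contDiffOn_succ_iff_fderiv_of_isOpen hU]
    refine ⟨hf, by simp, contDiffOn_clm_apply.2 fun v => ?_⟩
    exact ih (differentiableOn_fderiv_apply hf hU v)

end Osgood

/-! ### Growth of the iterated lift, and lifts of bounded polydiscs -/

theorem contDiff_polyMap {k : ℕ} (P : Fin (k + 1) → MvPolynomial (Fin (k + 1)) ℂ) :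
    ContDiff ℂ 1 (polyMap P) := by
  rw [contDiff_euclidean]
  intro i
  have h : (fun v : HomCoord k => polyMap P v i) = fun v => ∑ e ∈ (P i).support,
      (P i).coeff e * ∏ j, v j ^ e j := by
    ext v
    exact MvPolynomial.eval_eq' _ _
  rw [h]
  refine ContDiff.sum fun e _ => contDiff_const.mul (contDiff_prod fun j _ => ContDiff.pow ?_ _)
  exact (EuclideanSpace.proj (𝕜 := ℂ) j).contDiff

theorem polyMap_smul {k d : ℕ} {P : Fin (k + 1) → MvPolynomial (Fin (k + 1)) ℂ}
    (hP : ∀ i, (P i).IsHomogeneous d) (t : ℂ) (v : HomCoord k) :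
    polyMap P (t • v) = t ^ d • polyMap P v := by
  ext i
  change MvPolynomial.eval (fun j => t * v j) (P i) = t ^ d * MvPolynomial.eval (fun j => v j) (P i)
  rw [MvPolynomial.eval_eq', MvPolynomial.eval_eq', Finset.mul_sum]
  refine Finset.sum_congr rfl fun e he => ?_
  have h : ∑ j, e j = d := by
    have := hP i (MvPolynomial.mem_support_iff.1 he)
    rw [Finsupp.weight_apply, Finsupp.sum_fintype _ _ (by simp)] at this
    simpa using this
  simp only [mul_pow, Finset.prod_mul_distrib, Finset.prod_pow_eq_pow_sum, h]
  ring

/-- By homogeneity the difference depends only on `v / ‖v‖`, and it is continuous on the compact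
unit sphere, where the polynomials have no common zero. -/
theorem exists_abs_log_norm_polyMap_sub_le {k d : ℕ}
    {P : Fin (k + 1) → MvPolynomial (Fin (k + 1)) ℂ}
    (hP : ∀ i, (P i).IsHomogeneous d) (hP0 : ∀ v : HomCoord k, v ≠ 0 → polyMap P v ≠ 0) :
    ∃ c : ℝ, 0 ≤ c ∧ ∀ v : HomCoord k, v ≠ 0 →
      |Real.log ‖polyMap P v‖ - d * Real.log ‖v‖| ≤ c := by
  have hne : ∀ v ∈ Metric.sphere (0 : HomCoord k) 1, v ≠ 0 := by
    intro v hv h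
    simp [h] at hv
  have hcont : ContinuousOn (fun v => Real.log ‖polyMap P v‖) (Metric.sphere (0 : HomCoord k) 1) :=
    ContinuousOn.log (contDiff_polyMap P).continuous.norm.continuousOn
      fun v hv => norm_ne_zero_iff.2 (hP0 v (hne v hv))
  obtain ⟨c, hc⟩ := (isCompact_sphere (0 : HomCoord k) 1).exists_bound_of_continuousOn hcont
  refine ⟨|c|, abs_nonneg c, fun v hv => ?_⟩
  have hv' : ‖v‖ ≠ 0 := norm_ne_zero_iff.2 hv
  have hvC : ((‖v‖ : ℝ) : ℂ) ≠ 0 := by exact_mod_cast hv'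
  set w : HomCoord k := ((‖v‖ : ℝ) : ℂ)⁻¹ • v with hw
  have hw1 : w ∈ Metric.sphere (0 : HomCoord k) 1 := by
    rw [mem_sphere_zero_iff_norm, hw, norm_smul, norm_inv, Complex.norm_real, norm_norm,
      inv_mul_cancel₀ hv']
  have hvw : v = ((‖v‖ : ℝ) : ℂ) • w := by rw [hw, smul_inv_smul₀ hvC]
  have h1 : ‖polyMap P v‖ = ‖v‖ ^ d * ‖polyMap P w‖ := by
    conv_lhs => rw [hvw]
    rw [polyMap_smul hP, norm_smul, norm_pow, Complex.norm_real, norm_norm]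
  rw [h1, Real.log_mul (pow_ne_zero _ hv') (norm_ne_zero_iff.2 (hP0 w (hne w hw1))), Real.log_pow,
    add_sub_cancel_left]
  exact (hc w hw1).trans (le_abs_self c)

theorem iterate_ne_zero_of_forall {k : ℕ} {Q : HomCoord k → HomCoord k}
    (hQ : ∀ v, v ≠ 0 → Q v ≠ 0) (m : ℕ) : ∀ v, v ≠ 0 → Q^[m] v ≠ 0 := by
  induction m with
  | zero => exact fun v hv => hv
  | succ m ih =>
    intro v hv
    rw [Function.iterate_succ_apply']
    exact hQ _ (ih v hv)

theorem abs_log_norm_iterate_sub_le {k d : ℕ} (hd : 2 ≤ d) {Q : HomCoord k → HomCoord k}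
    (hQ : ∀ v, v ≠ 0 → Q v ≠ 0) {c : ℝ} (hc0 : 0 ≤ c)
    (hc : ∀ v, v ≠ 0 → |Real.log ‖Q v‖ - d * Real.log ‖v‖| ≤ c) (m : ℕ) :
    ∀ v, v ≠ 0 → |Real.log ‖Q^[m] v‖ - d ^ m * Real.log ‖v‖| ≤ c * (d ^ m - 1) := by
  have hd' : (2 : ℝ) ≤ d := by exact_mod_cast hd
  induction m with
  | zero => intro v hv; simp
  | succ m ih =>
    intro v hv
    have h1 := hc _ (iterate_ne_zero_of_forall hQ m v hv)
    have h2 := ih v hv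
    rw [Function.iterate_succ_apply']
    have h3 : |(d : ℝ) * (Real.log ‖Q^[m] v‖ - d ^ m * Real.log ‖v‖)| ≤ d * (c * (d ^ m - 1)) := by
      rw [abs_mul, abs_of_nonneg (by positivity : (0 : ℝ) ≤ d)]
      exact mul_le_mul_of_nonneg_left h2 (by positivity)
    rw [abs_le] at h1 h3 ⊢
    -- This is where `d ≥ 2` enters: the bound `c (d^m - 1)` absorbs one further error `c` because
    -- `d - 1 ≥ 1`.
    have h4 : (d : ℝ) * (c * (d ^ m - 1)) + c ≤ c * (d ^ (m + 1) - 1) := by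
      rw [pow_succ]
      nlinarith
    have h5 : (d : ℝ) * (d ^ m * Real.log ‖v‖) = d ^ (m + 1) * Real.log ‖v‖ := by ring
    rw [mul_sub (d : ℝ) (Real.log _), h5] at h3
    constructor <;> linarith

theorem iterate_mk_eq {k : ℕ} {f : CP k → CP k} {Q : HomCoord k → HomCoord k}
    (hQ : ∀ v, v ≠ 0 → Q v ≠ 0)
    (hf : ∀ v (hv : v ≠ 0), f (Projectivization.mk ℂ v hv) = Projectivization.mk ℂ (Q v) (hQ v hv))
    (m : ℕ) : ∀ v (hv : v ≠ 0), f^[m] (Projectivization.mk ℂ v hv)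
      = Projectivization.mk ℂ (Q^[m] v) (iterate_ne_zero_of_forall hQ m v hv) := by
  induction m with
  | zero => intro v hv; rfl
  | succ m ih =>
    intro v hv
    rw [Function.iterate_succ_apply', ih v hv, hf]
    simp only [Function.iterate_succ_apply']

/-- Boundedness in the chart gives the upper bound; the lower one holds because `ℓ = 1` on the image
of the chart, so the norm is at least `1 / ‖ℓ‖`. -/
theorem IsBoundedInAffineChart.exists_lift_bound {k : ℕ} {B : Set (CP k)}
    (hB : IsBoundedInAffineChart B) : ∃ ℓ : HomCoord k →L[ℂ] ℂ, B ⊆ affineOpen ℓ ∧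
      ∃ K : ℝ, ∀ p ∈ B, |Real.log ‖affineChart ℓ p‖| ≤ K := by
  obtain ⟨ℓ, hℓ, hb⟩ := hB
  obtain ⟨R, hR⟩ := isBounded_iff_forall_norm_le.1 hb
  refine ⟨ℓ, hℓ, |R| + |Real.log ‖ℓ‖|, fun p hp => ?_⟩
  have h1 : ‖affineChart ℓ p‖ ≤ R := hR _ (Set.mem_image_of_mem _ hp)
  have h2 : ℓ (affineChart ℓ p) = 1 := by
    unfold affineChart
    rw [map_smul, smul_eq_mul, inv_mul_cancel₀ (hℓ hp)]
  have h3 : 1 ≤ ‖ℓ‖ * ‖affineChart ℓ p‖ := by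
    have := ℓ.le_opNorm (affineChart ℓ p)
    rwa [h2, norm_one] at this
  have hℓ0 : ‖ℓ‖ ≠ 0 := by
    intro h
    rw [h, zero_mul] at h3
    linarith
  have ha0 : ‖affineChart ℓ p‖ ≠ 0 := by
    intro h
    rw [h, mul_zero] at h3
    linarith
  have h4 := Real.log_nonneg h3
  rw [Real.log_mul hℓ0 ha0] at h4
  have h5 : Real.log ‖affineChart ℓ p‖ ≤ |R| :=
    ((Real.log_le_sub_one_of_pos (lt_of_le_of_ne (norm_nonneg _) ha0.symm)).trans
      (by linarith)).trans (le_abs_self R)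
  rw [abs_le]
  constructor
  · linarith [le_abs_self (Real.log ‖ℓ‖), abs_nonneg R]
  · linarith [abs_nonneg (Real.log ‖ℓ‖)]

theorem mk_affineChart {k : ℕ} {ℓ : HomCoord k →L[ℂ] ℂ} {p : CP k} (hp : p ∈ affineOpen ℓ) :
    ∃ h : affineChart ℓ p ≠ 0, p = Projectivization.mk ℂ (affineChart ℓ p) h := by
  have hc : (ℓ p.rep)⁻¹ ≠ 0 := inv_ne_zero hp
  have h0 : affineChart ℓ p ≠ 0 := smul_ne_zero hc p.rep_nonzero
  refine ⟨h0, ?_⟩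
  conv_lhs => rw [← p.mk_rep]
  refine (Projectivization.mk_eq_mk_iff' ℂ _ _ p.rep_nonzero h0).2 ⟨ℓ p.rep, ?_⟩
  unfold affineChart
  rw [smul_inv_smul₀ (show ℓ p.rep ≠ 0 from hp)]

/-- The volume of a polydisc with a holomorphic lift `G` such that `log ‖G‖ = O(A)` is `O(A^l)`. -/
theorem volume_le_of_lift {k l : ℕ} {C : ℝ}
    (hC : ∀ u : (Fin l → ℂ) → ℝ, ContDiffOn ℝ 3 u (Metric.ball 0 2) →
      (∀ x ∈ Metric.ball (0 : Fin l → ℂ) 2, 0 ≤ u x ∧ u x ≤ 1) →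
      (∀ x ∈ Metric.ball (0 : Fin l → ℂ) 2, ∀ a, 0 ≤ levi u x a (Complex.I • a)) →
      IntegrableOn (fun x => wedgePow (levi u x) l (realFrame l)) (Metric.ball 0 1) ∧
      ∫ x in Metric.ball 0 1, wedgePow (levi u x) l (realFrame l) ≤ C)
    {η : (Fin l → ℂ) → CP k} {G : (Fin l → ℂ) → HomCoord k}
    (hG : DifferentiableOn ℂ G (Metric.ball 0 2))
    (hη : ∀ x ∈ Metric.ball (0 : Fin l → ℂ) 2,
      ∃ h : G x ≠ 0, η x = Projectivization.mk ℂ (G x) h)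
    {A : ℝ} (hA : 0 < A) (hGA : ∀ x ∈ Metric.ball (0 : Fin l → ℂ) 2, |Real.log ‖G x‖| ≤ A) :
    IntegrableOn (volumeDensity η) (polydisc l 1) ∧
      polydiscVolume η 1 ≤ (A / Real.pi) ^ l * C := by
  have hpi := Real.pi_pos
  have hGC : ∀ x ∈ Metric.ball (0 : Fin l → ℂ) 2, ContDiffAt ℂ 3 G x := fun x hx =>
    (contDiffOn_of_differentiableOn_complex hG Metric.isOpen_ball 3).contDiffAt
      (Metric.isOpen_ball.mem_nhds hx)
  -- As `log ‖G‖²` lies in `[-2A, 2A]`, this scaling and the shift by `1/2` bring `u` into `[0, 1]`.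
  set s : ℝ := (4 * A)⁻¹ with hs
  have hs0 : 0 < s := by positivity
  set u : (Fin l → ℂ) → ℝ := fun x => s * Real.log (‖G x‖ ^ 2) + 1 / 2 with hu
  have hlogC : ∀ x ∈ Metric.ball (0 : Fin l → ℂ) 2,
      ContDiffAt ℝ 3 (fun y => Real.log (‖G y‖ ^ 2)) x := fun x hx =>
    (contDiffAt_normSq_comp (hGC x hx)).log
      (pow_ne_zero _ (norm_ne_zero_iff.2 (hη x hx).choose))
  have hlevi : ∀ x ∈ Metric.ball (0 : Fin l → ℂ) 2, ∀ a b, levi u x a b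
      = s * (4 * Real.pi * fubiniStudy (G x) (fderiv ℂ G x a) (fderiv ℂ G x b)) := by
    intro x hx a b
    have h1 : levi u x a b = _ :=
      levi_add_const (fun x => s * Real.log (‖G x‖ ^ 2)) (1 / 2) x a b
    rw [h1, levi_const_mul ((hlogC x hx).of_le (by norm_num)),
      levi_log_normSq ((hGC x hx).of_le (by norm_num)) (hη x hx).choose]
  obtain ⟨hint, hle⟩ := hC u
    (fun x hx => ((contDiffAt_const.mul (hlogC x hx)).add contDiffAt_const).contDiffWithinAt)
    (fun x hx => by
      have h1 := abs_le.1 (hGA x hx)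
      have h2 : u x = Real.log ‖G x‖ / (2 * A) + 1 / 2 := by
        simp only [hu, hs, Real.log_pow]
        field_simp
        push_cast
        ring
      have h3 : Real.log ‖G x‖ / (2 * A) ≤ 1 / 2 := by
        rw [div_le_iff₀ (by positivity)]
        linarith
      have h4 : -(1 / 2) ≤ Real.log ‖G x‖ / (2 * A) := by
        rw [le_div_iff₀ (by positivity)]
        linarith
      rw [h2]
      constructor <;> linarith)
    (fun x hx a => by
      rw [hlevi x hx, map_smul]
      exact mul_nonneg hs0.le (mul_nonneg (by positivity) (fubiniStudy_I_smul_nonneg _ _)))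
  have hdens : Set.EqOn (fun x => (A / Real.pi) ^ l * wedgePow (levi u x) l (realFrame l))
      (volumeDensity η) (Metric.ball 0 1) := by
    intro x hx
    have hx2 : x ∈ Metric.ball (0 : Fin l → ℂ) 2 := Metric.ball_subset_ball (by norm_num) hx
    -- The factor `4πs = π / A` relates `dd^c u` to the pull-back; its inverse enters to the power
    -- `l`.
    have h1 : pullbackFS η x = fun a b => A / Real.pi * levi u x a b := by
      ext a b
      rw [hlevi x hx2, pullbackFS_eq η x a b G ((hGC x hx2).differentiableAt (by norm_num))
        (by filter_upwards [Metric.isOpen_ball.mem_nhds hx2] with y hy using hη y hy)]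
      simp only [hs]
      field_simp
    simp only [volumeDensity]
    rw [h1, wedgePow_smul]
  unfold polydiscVolume polydisc
  refine ⟨IntegrableOn.congr_fun (hint.const_mul _) hdens measurableSet_ball, ?_⟩
  rw [← setIntegral_congr_fun measurableSet_ball hdens, integral_const_mul]
  exact mul_le_mul_of_nonneg_left hle (by positivity)

end

/-! ### The growth estimate -/

theorem mainTheorem3 {k d : ℕ} (hd : 2 ≤ d)
    (f : CP k → CP k) (hf : IsEndomorphismOfDegree d f)
    {J : Type*} [Finite J] (B : J → Set (CP k))
    (hB_open : ∀ j, IsOpen (B j)) (hB_cover : (⋃ j, B j) = Set.univ)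
    (hB_bdd : ∀ j, IsBoundedInAffineChart (B j)) :
    ∃ C : ℝ, 0 < C ∧ ∀ l : ℕ, 1 ≤ l → l ≤ k →
      ∀ η : (Fin l → ℂ) → CP k,
        IsHolomorphicOn η (polydisc l 2) → IsBoundedPolydisc B η 2 →
        ∀ m : ℕ, 1 ≤ m →
          IntegrableOn (volumeDensity (f^[m] ∘ η)) (polydisc l 1) ∧
          polydiscVolume (f^[m] ∘ η) 1 ≤ C * (d : ℝ) ^ (l * m) := by
  obtain ⟨P, hPh, hP0, hPf⟩ := hf
  obtain ⟨c, hc0, hc⟩ := exists_abs_log_norm_polyMap_sub_le hPh hP0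
  choose ℓ hℓ κ hκ using fun j => (hB_bdd j).exists_lift_bound
  obtain ⟨K, hK⟩ := (Set.finite_range κ).bddAbove
  choose M hM0 hM using exists_integral_wedgePow_levi_le
  have hd0 : (0 : ℝ) < d := by exact_mod_cast (by omega : 0 < d)
  -- Along the orbit `|log ‖G‖| ≤ d^m |K| + c (d^m - 1) ≤ A d^m`; the `1` ensures `A > 0`.
  set A : ℝ := c + |K| + 1 with hA
  have hA0 : 0 < A := by positivity
  have hpi := Real.pi_pos
  have hterm : ∀ l, 0 < (A / Real.pi) ^ l * M l := fun l => mul_pos (by positivity) (hM0 l)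
  -- Summing the positive constants over all `l ≤ k` gives one that serves every dimension `l`.
  refine ⟨∑ l ∈ Finset.range (k + 1), (A / Real.pi) ^ l * M l,
    Finset.sum_pos (fun l _ => hterm l) (by simp), fun l _ hlk η hη hηB m _ => ?_⟩
  obtain ⟨j, hj⟩ := hηB
  set F : (Fin l → ℂ) → HomCoord k := fun x => affineChart (ℓ j) (η x) with hF
  have hmem : ∀ x ∈ Metric.ball (0 : Fin l → ℂ) 2, η x ∈ affineOpen (ℓ j) :=
    fun x hx => hℓ j (hj hx)
  have hFd : DifferentiableOn ℂ F (Metric.ball 0 2) :=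
    (hη.2 (ℓ j)).mono fun x hx => ⟨hx, hmem x hx⟩
  have hPd : Differentiable ℂ (polyMap P)^[m] :=
    ((contDiff_polyMap P).differentiable (by norm_num)).iterate m
  have hdm : (0 : ℝ) < d ^ m := by positivity
  obtain ⟨h1, h2⟩ := volume_le_of_lift (hM l) (η := f^[m] ∘ η) (G := (polyMap P)^[m] ∘ F)
    (hPd.comp_differentiableOn hFd)
    (fun x hx => by
      obtain ⟨h, hx'⟩ := mk_affineChart (hmem x hx)
      refine ⟨iterate_ne_zero_of_forall hP0 m _ h, ?_⟩
      rw [Function.comp_apply, hx', iterate_mk_eq hP0 hPf]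
      simp only [Function.comp_apply, hF])
    (A := A * d ^ m) (by positivity)
    (fun x hx => by
      obtain ⟨h, -⟩ := mk_affineChart (hmem x hx)
      have h1 := abs_log_norm_iterate_sub_le hd hP0 hc0 hc m (F x) h
      have h2 : |Real.log ‖F x‖| ≤ |K| :=
        ((hκ j _ (hj hx)).trans (hK (Set.mem_range_self j))).trans (le_abs_self K)
      have h3 : |(d : ℝ) ^ m * Real.log ‖F x‖| ≤ d ^ m * |K| := by
        rw [abs_mul, abs_of_pos hdm]
        exact mul_le_mul_of_nonneg_left h2 hdm.le
      rw [abs_le] at h1 h3 ⊢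
      simp only [Function.comp_apply, hA]
      constructor <;> nlinarith)
  refine ⟨h1, h2.trans ?_⟩
  have h3 : (A * (d : ℝ) ^ m / Real.pi) ^ l * M l = (A / Real.pi) ^ l * M l * d ^ (l * m) := by
    rw [mul_comm l m, pow_mul, mul_div_right_comm, mul_pow]
    ring
  rw [h3]
  refine mul_le_mul_of_nonneg_right ?_ (by positivity)
  exact Finset.single_le_sum (f := fun l => (A / Real.pi) ^ l * M l) (fun l _ => (hterm l).le)
    (Finset.mem_range.2 (by omega))
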